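/- Let $r\ge 1$ be an odd integer. Let $\Lambda_{\mathbb Q}$ be the $\mathbb Q$-algebra of symmetric functions in countably many variables $x=(x_1,x_2,\ldots)$, let $p_j=x_1^j+x_2^j+\cdots$ be the power sums, and put $$\Gamma_{\mathbb Q}=\mathbb Q[\,p_j : j\ge 1 \text{ odd}\,]\subset\Lambda_{\mathbb Q},\qquad \Gamma^{(r)}_{\mathbb Q}=\mathbb Q[\,p_j : j\ge 1 \text{ odd},\ r\nmid j\,]\subset\Gamma_{\mathbb Q}.$$ For a strict partition $\lambda=(\lambda_1>\cdots>\lambda_l>0)$ let $Q_\lambda(x)$ be Schur's $Q$-function, i.e. the Hall–Littlewood symmetric function $Q_\lambda(x;t)$ at $t=-1$, where $$Q_\lambda(x_1,\ldots,x_n;t)=(1-t)^{l}\sum_{w\in S_n/S_{n-l}} w\Bigl(x_1^{\lambda_1}\cdots x_l^{\lambda_l}\prod_{i=1}^{l}\prod_{k=i+1}^{n}\frac{x_i-t x_k}{x_i-x_k}\Bigr)\qquad(n\ge l)$$ and $Q_\lambda(x_1,\ldots,x_n;t)=0$ for $n<l$. One has $Q_\lambda(x)\in\Gamma_{\mathbb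 Q}$, and the $r$-reduced $Q$-function $$Q^{(r)}_\lambda(x)=Q_\lambda(x)\big|_{p_r=p_{3r}=p_{5r}=\cdots=0}\in\Gamma^{(r)}_{\mathbb Q}$$ is its image under the (well-defined) $\mathbb Q$-algebra homomorphism $\Gamma_{\mathbb Q}\to\Gamma^{(r)}_{\mathbb Q}$ that sends $p_j$ to $0$ if $r\mid j$ and to $p_j$ if $r\nmid j$ ($j$ odd). Let $\lambda^0$ be the zeroth component of the $r$-bar quotient of $\lambda$, i.e. the strict partition whose parts are the integers $x$ such that $rx$ is a part of $\lambda$. Then the family $\bigl(Q^{(r)}_\lambda(x)\bigr)$, with $\lambda$ running over the strict partitions such that $\lambda^0=\emptyset$, is a basis of the $\mathbb Q$-vector space $\Gamma^{(r)}_{\mathbb Q}$. -/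

import Mathlib

open MvPolynomial

/-- A strict partition `λ₁ > λ₂ > ⋯ > λₗ > 0`, given by its list of parts. -/
@[ext] structure StrictPartition where
  parts : List ℕ
  strict : parts.Pairwise (· > ·)
  pos : ∀ k ∈ parts, 0 < k

namespace StrictPartition

/-- The length `ℓ(λ)`. -/
def length (μ : StrictPartition) : ℕ := μ.parts.length

/-- The part `λ_i` (with indices starting at `0`). -/
def part (μ : StrictPartition) (i : Fin μ.length) : ℕ := μ.parts.get i

/-- The sequence `X^i(λ) = {x ∈ ℕ : λ_k = r x + i for some k}`. -/
def barRunner (μ : StrictPartition) (r i : ℕ) : Set ℕ :=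
  {x | ∃ k, μ.part k = r * x + i}

/-- The component `λ⁰ = X⁰(λ)` of the `r`-bar quotient of `λ`: the strict partition `λ⁰`, given as
the set of its parts. -/
def barQuotientZero (μ : StrictPartition) (r : ℕ) : Set ℕ := μ.barRunner r 0

end StrictPartition

noncomputable section

/-- Setting the last variable equal to `0`:
`f(x₁, …, xₙ, xₙ₊₁) ↦ f(x₁, …, xₙ, 0)`. -/
def dropLast (n : ℕ) : MvPolynomial (Fin (n + 1)) ℚ →ₐ[ℚ] MvPolynomial (Fin n) ℚ :=
  aeval (Fin.snoc (α := fun _ => MvPolynomial (Fin n) ℚ) X 0)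

/-- The `ℚ`-algebra `Λ_ℚ` of symmetric functions in countably many variables `x₁, x₂, …`, as the
graded inverse limit of the rings of symmetric polynomials: an element is a sequence of symmetric
polynomials `f n = f(x₁, …, xₙ)` of bounded degree with `f(x₁, …, xₙ, 0) = f(x₁, …, xₙ)`. -/
def symmFun : Subalgebra ℚ (∀ n : ℕ, MvPolynomial (Fin n) ℚ) where
  carrier := {f | (∀ n, (f n).IsSymmetric) ∧ (∀ n, dropLast n (f (n + 1)) = f n) ∧
    ∃ d, ∀ n, (f n).totalDegree ≤ d}
  mul_mem' := by
    rintro f g ⟨hf, hf', d, hd⟩ ⟨hg, hg', e, he⟩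
    refine ⟨fun n => (hf n).mul (hg n), fun n => ?_, d + e, fun n => ?_⟩
    · simp [hf', hg']
    · exact (totalDegree_mul _ _).trans (add_le_add (hd n) (he n))
  add_mem' := by
    rintro f g ⟨hf, hf', d, hd⟩ ⟨hg, hg', e, he⟩
    refine ⟨fun n => (hf n).add (hg n), fun n => ?_, max d e, fun n => ?_⟩
    · simp [hf', hg']
    · exact (totalDegree_add _ _).trans (max_le_max (hd n) (he n))
  algebraMap_mem' := by
    intro c
    refine ⟨fun n => IsSymmetric.C c, fun n => ?_, 0, fun n => ?_⟩
    · exact (dropLast n).commutes c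
    · exact (totalDegree_C c).le

/-- The power sum `p_j = x₁^j + x₂^j + ⋯` for `j ≥ 1`, as an element of `Λ_ℚ`. -/
def powerSum (j : ℕ) (hj : j ≠ 0) : symmFun :=
  ⟨fun n => psum (Fin n) ℚ j, fun n => psum_isSymmetric _ _ _, fun n => by
    simp [dropLast, psum, Fin.sum_univ_castSucc, hj], j, fun n => by
    refine totalDegree_finsetSum_le fun i _ => ?_
    simp [totalDegree_X_pow]⟩

/-- `Γ_ℚ = ℚ[p₁, p₃, p₅, …]`, the subalgebra of `Λ_ℚ` generated by the odd power sums. -/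
def gammaQ : Subalgebra ℚ symmFun :=
  Algebra.adjoin ℚ {f | ∃ (j : ℕ) (hj : Odd j), f = powerSum j hj.pos.ne'}

/-- `Γ^{(r)}_ℚ`, the subalgebra generated by the `p_j` with `j` odd and not divisible by `r`. -/
def gammaRQ (r : ℕ) : Subalgebra ℚ symmFun :=
  Algebra.adjoin ℚ {f | ∃ (j : ℕ) (hj : Odd j), ¬ r ∣ j ∧ f = powerSum j hj.pos.ne'}

lemma powerSum_mem_gammaQ {j : ℕ} (hj : Odd j) : powerSum j hj.pos.ne' ∈ gammaQ :=
  Algebra.subset_adjoin ⟨j, hj, rfl⟩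

lemma powerSum_mem_gammaRQ {r j : ℕ} (hj : Odd j) (hr : ¬ r ∣ j) :
    powerSum j hj.pos.ne' ∈ gammaRQ r :=
  Algebra.subset_adjoin ⟨j, hj, hr, rfl⟩

/-- The Hall-Littlewood function `Q_λ(x₁, …, xₙ; t)` of a partition `λ` of length `l`,
`(1 - t)^l ∑_{w ∈ Sₙ / Sₙ₋ₗ} w (x^λ ∏_{i ≤ l} ∏_{k > i} (x_i - t x_k) / (x_i - x_k))`,
for distinct elements `x₁, …, xₙ` of a field (below: independent variables in the field of rational
functions). A coset `w Sₙ₋ₗ` is the injection `e = w|_{{1, …, l}}`, and `w {k : k > i}` is the set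
of all `k` that are none of `e 1, …, e i`.
(If `l > n` there is no such injection, and the value is `0`.) -/
def hallLittlewoodQ {F : Type*} [Field F] {n : ℕ} (x : Fin n → F) (t : F)
    (μ : StrictPartition) : F :=
  (1 - t) ^ μ.length * ∑ e : Fin μ.length ↪ Fin n, ∏ i : Fin μ.length,
    (x (e i) ^ μ.part i *
      ∏ k : Fin n with ∀ i' ≤ i, k ≠ e i', (x (e i) - t * x k) / (x (e i) - x k))

/-- The symmetric function `f` is Schur's `Q`-function `Q_λ(x) = Q_λ(x; -1)`: for every `n` its
restriction to `n` variables is `Q_λ(x₁, …, xₙ; -1)`. -/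
def IsSchurQ (μ : StrictPartition) (f : symmFun) : Prop :=
  ∀ n, algebraMap (MvPolynomial (Fin n) ℚ) (FractionRing (MvPolynomial (Fin n) ℚ)) (f.1 n) =
    hallLittlewoodQ (fun i => algebraMap (MvPolynomial (Fin n) ℚ) _ (X i)) (-1) μ

/-- `Q_λ` is the only symmetric function with this property. -/
lemma IsSchurQ.unique {μ : StrictPartition} {f g : symmFun} (hf : IsSchurQ μ f)
    (hg : IsSchurQ μ g) : f = g := by
  refine Subtype.ext (funext fun n => ?_)
  have h := (hf n).trans (hg n).symm
  exact IsFractionRing.injective _ _ h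

/-- The algebra homomorphism `ρ : Γ_ℚ → Γ^{(r)}_ℚ` is the substitution
`f ↦ f|_{p_r = p_{3r} = p_{5r} = ⋯ = 0}`. -/
def IsReduction (r : ℕ) (ρ : gammaQ →ₐ[ℚ] gammaRQ r) : Prop :=
  ∀ (j : ℕ) (hj : Odd j),
    (r ∣ j → ρ ⟨powerSum j hj.pos.ne', powerSum_mem_gammaQ hj⟩ = 0) ∧
    ∀ h : ¬ r ∣ j, ρ ⟨powerSum j hj.pos.ne', powerSum_mem_gammaQ hj⟩ =
      ⟨powerSum j hj.pos.ne', powerSum_mem_gammaRQ hj h⟩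

/-- There is at most one such homomorphism. -/
lemma IsReduction.unique {r : ℕ} {ρ σ : gammaQ →ₐ[ℚ] gammaRQ r} (hρ : IsReduction r ρ)
    (hσ : IsReduction r σ) : ρ = σ := by
  refine AlgHom.adjoin_ext fun f hf => ?_
  obtain ⟨j, hj, rfl⟩ := hf
  by_cases h : r ∣ j
  · exact ((hρ j hj).1 h).trans ((hσ j hj).1 h).symm
  · exact ((hρ j hj).2 h).trans ((hσ j hj).2 h).symm

end

/-! Everything happens in the polynomial ring in the odd `p_k`. The operator `B_a` = `vertexOp a`
replaces `p_k` by `p_k - z^k` and then `z^m` by `q_{a+m}`. In finitely many variables it becomes,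
for `a > 0`, `f ↦ ∑ 2 x_i^a ∏_{k ≠ i} (x_i + x_k)/(x_i - x_k) · f(x without x_i)`, so `Q_λ = B_{λ₁}
⋯ B_{λₗ} 1` (`evalOn_univ_schurWord`). For odd `k` one has `p_k B_a = B_a p_k + B_{a+k}`; the `B_a`
with `a > 0` anticommute (`vertexOp_anticomm`); and an odd `p_m` is a combination of `B_m 1` and the
`B_{m-j} B_j 1` (`oddVar_eq_sum`).

Spanning: let `D` = `dilate r` be the linear map `Q_λ ↦ Q_{rλ}`. In the expansion of `p_{rk}` the
terms with `r ∣ j` form `D p_k`; the others form an even operator `N` that commutes with every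
`B_a`, `a > 0`. This gives `p_{rk} · D f = D (p_k f) + N (D f)` (`oddVar_mul_dilate`). After
reduction `p_{rk}` vanishes, so `D (p_k f)` can be traded for `-N (D f)`, and `N` only adds parts
not divisible by `r`. Induction on `f` puts every `B_{a₁} ⋯ B_{aₛ} D f` with `r ∤ a_i` into the
reduced span (`vertexOps_dilate_mem_reducedSpan`), and each `Q_λ` has this form up to sign.

Independence: Glaisher's map injects the strict partitions without parts divisible by `r` into the
monomials of the same weight, so in each weight the spanning family is no larger than the dimension.
-/

/-! ### The polynomial ring in the odd power sums and the series of the `q_n`. -/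

/-- The odd natural numbers that are not divisible by `r`. -/
abbrev OddIndex (r : ℕ) : Type := {j : ℕ // Odd j ∧ ¬ r ∣ j}

/-- The polynomial ring in the variables `p_j` with `j` odd and not divisible by `r`. -/
abbrev OddPoly (r : ℕ) : Type := MvPolynomial (OddIndex r) ℚ

/-- Since `0` divides only `0`, the index `r = 0` removes nothing: `OddPoly 0` models the unreduced
ring. -/
lemma odd_index_zero {k : ℕ} (hk : Odd k) : Odd k ∧ ¬ 0 ∣ k :=
  ⟨hk, fun h => by simp [zero_dvd_iff.1 h] at hk⟩

noncomputable section

/-- The variable `p_k`, with the convention that `p_k = 0` for even `k`. -/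
def oddVar (k : ℕ) : OddPoly 0 :=
  if hk : Odd k then X ⟨k, odd_index_zero hk⟩ else 0

lemma oddVar_of_odd {k : ℕ} (hk : Odd k) : oddVar k = X ⟨k, odd_index_zero hk⟩ := dif_pos hk

lemma oddVar_of_not_odd {k : ℕ} (hk : ¬ Odd k) : oddVar k = 0 := dif_neg hk

lemma oddVar_index (i : OddIndex 0) : oddVar i = X i := oddVar_of_odd i.2.1

/-- The polynomials `q_n` with `∑ q_n u^n = exp (2 ∑ p_k u^k / k)`. -/
def schurq : ℕ → OddPoly 0
  | 0 => 1
  | n + 1 => ((2 : ℚ) / (n + 1)) • ∑ k : Fin (n + 1), oddVar (k + 1) * schurq (n - k)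

lemma schurq_zero : schurq 0 = 1 := by rw [schurq]

lemma schurq_succ (n : ℕ) :
    ((n : OddPoly 0) + 1) * schurq (n + 1) =
      2 * ∑ k ∈ Finset.range (n + 1), oddVar (k + 1) * schurq (n - k) := by
  have h : ((n : ℚ) + 1) ≠ 0 := by positivity
  rw [schurq, ← Fin.sum_univ_eq_sum_range (fun k => oddVar (k + 1) * schurq (n - k)), smul_eq_C_mul,
    ← mul_assoc]
  congr 1
  rw [show ((n : OddPoly 0) + 1) = C ((n : ℚ) + 1) by simp, ← C_mul, mul_div_cancel₀ _ h]
  exact map_ofNat C 2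

/-- The generating series of the `q_n`. -/
def schurqSeries : PowerSeries (OddPoly 0) := PowerSeries.mk schurq

/-- The generating series of the `p_k`. -/
def oddVarSeries : PowerSeries (OddPoly 0) := PowerSeries.mk oddVar

lemma oddVar_zero : oddVar 0 = 0 := oddVar_of_not_odd (by simp)

/-- This differential equation, `u q'(u) = 2 p(u) q(u)`, takes the place of the exponential formula
for `q(u)`. -/
lemma X_mul_derivative_schurqSeries :
    PowerSeries.X * PowerSeries.derivative (OddPoly 0) schurqSeries =
      2 * oddVarSeries * schurqSeries := by
  ext n : 1
  rw [mul_assoc, show (2 : PowerSeries (OddPoly 0)) = PowerSeries.C 2 from rfl,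
    PowerSeries.coeff_C_mul]
  cases n with
  | zero => simp [oddVarSeries, oddVar_zero]
  | succ n =>
    rw [PowerSeries.coeff_succ_X_mul, PowerSeries.coeff_derivative, PowerSeries.coeff_mul,
      Finset.Nat.sum_antidiagonal_eq_sum_range_succ_mk, Finset.sum_range_succ']
    simp only [schurqSeries, oddVarSeries, PowerSeries.coeff_mk, oddVar_zero, zero_mul, add_zero,
      Nat.add_sub_add_right]
    rw [mul_comm, schurq_succ]

/-- Uniqueness for a first-order equation: as `T` has no constant term, the coefficient of `u^{n+1}`
reads `(n+1) F_{n+1} = 0` once the lower ones vanish. -/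
lemma PowerSeries.eq_zero_of_X_mul_derivative {R : Type*} [CommRing R] [Algebra ℚ R]
    {F T : PowerSeries R} {y : R} (hT : PowerSeries.coeff 0 T = 0)
    (hF : PowerSeries.coeff 0 F = 0)
    (h : (1 + PowerSeries.C y * PowerSeries.X) * (PowerSeries.X * PowerSeries.derivative R F) =
      T * F) : F = 0 := by
  ext n
  induction n using Nat.strong_induction_on with
  | _ n ih =>
    cases n with
    | zero => simpa using hF
    | succ n =>
      have h1 := congrArg (PowerSeries.coeff (n + 1)) h
      have h2 : PowerSeries.coeff (n + 1) (T * F) = 0 := by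
        rw [PowerSeries.coeff_mul]
        refine Finset.sum_eq_zero fun a ha => ?_
        have ha := Finset.HasAntidiagonal.mem_antidiagonal.1 ha
        rcases Nat.eq_zero_or_pos a.1 with h0 | h0
        · rw [h0, hT, zero_mul]
        · rw [ih a.2 (by omega), map_zero, mul_zero]
      have h3 : PowerSeries.coeff n (PowerSeries.X * PowerSeries.derivative R F) = 0 := by
        cases n with
        | zero => simp
        | succ n =>
          rw [PowerSeries.coeff_succ_X_mul, PowerSeries.coeff_derivative, ih (n + 1) (by omega),
            map_zero, zero_mul]
      rw [h2, add_mul, one_mul, mul_assoc, map_add, PowerSeries.coeff_C_mul,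
        PowerSeries.coeff_succ_X_mul, PowerSeries.coeff_succ_X_mul, h3, mul_zero, add_zero,
        PowerSeries.coeff_derivative] at h1
      have h4 : ((n : R) + 1) = algebraMap ℚ R (n + 1) := by simp
      have h5 : algebraMap ℚ R (n + 1) * algebraMap ℚ R (n + 1)⁻¹ = 1 := by
        rw [← map_mul, mul_inv_cancel₀ (by positivity), map_one]
      rw [h4] at h1
      calc _ = PowerSeries.coeff (n + 1) F * (algebraMap ℚ R (n + 1) * algebraMap ℚ R (n + 1)⁻¹) := by
            rw [h5, mul_one]
        _ = 0 := by rw [← mul_assoc, h1, zero_mul]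
        _ = _ := by simp

lemma PowerSeries.map_derivative {R S : Type*} [CommRing R] [CommRing S] (φ : R →+* S)
    (F : PowerSeries R) : PowerSeries.map φ (PowerSeries.derivative R F) =
      PowerSeries.derivative S (PowerSeries.map φ F) := by
  ext n
  simp [PowerSeries.coeff_derivative]

/-- The generating series of the odd powers of `y`. -/
lemma one_sub_mul_one_add_mul_oddPow {R : Type*} [CommRing R] (y : R) :
    (1 - PowerSeries.C y * PowerSeries.X) * (1 + PowerSeries.C y * PowerSeries.X) *
      PowerSeries.mk (fun k => if Odd k then y ^ k else 0) = PowerSeries.C y * PowerSeries.X := by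
  have h : (1 - PowerSeries.C y * PowerSeries.X) * (1 + PowerSeries.C y * PowerSeries.X) =
      1 - PowerSeries.C (y ^ 2) * PowerSeries.X ^ 2 := by
    rw [map_pow]; ring
  rw [h, sub_mul, one_mul]
  ext n
  rw [map_sub, mul_assoc, PowerSeries.coeff_C_mul, PowerSeries.coeff_C_mul, PowerSeries.coeff_X]
  rcases n with _ | _ | n
  · simp
  · rw [PowerSeries.coeff_X_pow_mul']; simp
  · rw [PowerSeries.coeff_X_pow_mul']
    have : Odd (n + 1 + 1) ↔ Odd n := by simp [parity_simps]
    by_cases hn : Odd n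
    · simp [this, hn]; ring
    · simp [this, hn]

section AddVariable

variable {R : Type*} [CommRing R] [Algebra ℚ R]

/-- How the series of the `q_n` changes when a variable `y` is added. -/
lemma map_schurqSeries_add_variable {φ ψ : OddPoly 0 →ₐ[ℚ] R} {y : R}
    (h : ∀ k, Odd k → ψ (oddVar k) = φ (oddVar k) + y ^ k) :
    (1 - PowerSeries.C y * PowerSeries.X) * PowerSeries.map ψ.toRingHom schurqSeries =
      (1 + PowerSeries.C y * PowerSeries.X) * PowerSeries.map φ.toRingHom schurqSeries := by
  have key (χ : OddPoly 0 →ₐ[ℚ] R) :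
      PowerSeries.X * PowerSeries.derivative R (PowerSeries.map χ.toRingHom schurqSeries) =
        2 * PowerSeries.map χ.toRingHom oddVarSeries *
          PowerSeries.map χ.toRingHom schurqSeries := by
    have := congrArg (PowerSeries.map χ.toRingHom) X_mul_derivative_schurqSeries
    simpa [PowerSeries.map_derivative, map_ofNat] using this
  have hP : PowerSeries.map ψ.toRingHom oddVarSeries = PowerSeries.map φ.toRingHom oddVarSeries +
      PowerSeries.mk (fun k => if Odd k then y ^ k else 0) := by
    ext k
    by_cases hk : Odd k
    · simp [oddVarSeries, h k hk, hk]
    · simp [oddVarSeries, oddVar_of_not_odd hk, hk]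
  have hφ := key φ
  have hψ := key ψ
  have hy := one_sub_mul_one_add_mul_oddPow y
  rw [hP] at hψ
  set E := PowerSeries.map ψ.toRingHom schurqSeries with hE
  set F := PowerSeries.map φ.toRingHom schurqSeries with hF
  set P := PowerSeries.map φ.toRingHom oddVarSeries with hPd
  set O := PowerSeries.mk (fun k => if Odd k then y ^ k else 0)
  -- Both sides solve `(1 + yu) u G' = T G` with this `T` and have constant term `1`, so their
  -- difference vanishes.
  refine sub_eq_zero.1 (PowerSeries.eq_zero_of_X_mul_derivative (y := y)
    (T := 2 * P * (1 + PowerSeries.C y * PowerSeries.X) + PowerSeries.C y * PowerSeries.X) ?_ ?_ ?_)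
  · have : PowerSeries.constantCoeff P = 0 := by
      rw [hPd, ← PowerSeries.coeff_zero_eq_constantCoeff_apply, PowerSeries.coeff_map]
      simp [oddVarSeries, oddVar_zero, -PowerSeries.coeff_zero_eq_constantCoeff]
    simp [this]
  · have h1 (χ : OddPoly 0 →ₐ[ℚ] R) :
        PowerSeries.constantCoeff (PowerSeries.map χ.toRingHom schurqSeries) = 1 := by
      rw [← PowerSeries.coeff_zero_eq_constantCoeff_apply, PowerSeries.coeff_map]
      simp [schurqSeries, schurq_zero, -PowerSeries.coeff_zero_eq_constantCoeff]
    simp [hE, hF, h1, -AlgHom.toRingHom_eq_coe]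
  · simp only [map_sub, map_add, Derivation.leibniz, PowerSeries.derivative_X, smul_eq_mul,
      PowerSeries.derivative_C, Derivation.map_one_eq_zero]
    linear_combination (1 + PowerSeries.C y * PowerSeries.X) *
      ((1 - PowerSeries.C y * PowerSeries.X) * hψ - (1 + PowerSeries.C y * PowerSeries.X) * hφ)
      + 2 * E * hy

lemma map_schurq_add_variable {φ ψ : OddPoly 0 →ₐ[ℚ] R} {y : R}
    (h : ∀ k, Odd k → ψ (oddVar k) = φ (oddVar k) + y ^ k) (n : ℕ) :
    ψ (schurq (n + 1)) - y * ψ (schurq n) = φ (schurq (n + 1)) + y * φ (schurq n) := by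
  have := congrArg (PowerSeries.coeff (n + 1)) (map_schurqSeries_add_variable h)
  simp only [sub_mul, add_mul, one_mul, mul_assoc, map_sub, map_add, PowerSeries.coeff_C_mul,
    PowerSeries.coeff_succ_X_mul] at this
  simpa [schurqSeries] using this

end AddVariable

/-- The series `∑ (-1)^n q_n u^n`. -/
def schurqNegSeries : PowerSeries (OddPoly 0) := PowerSeries.mk fun n => (-1) ^ n * schurq n

lemma X_mul_derivative_schurqNegSeries :
    PowerSeries.X * PowerSeries.derivative (OddPoly 0) schurqNegSeries =
      -(2 * oddVarSeries * schurqNegSeries) := by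
  have h := congrArg (PowerSeries.rescale (-1 : OddPoly 0)) X_mul_derivative_schurqSeries
  have h1 : PowerSeries.rescale (-1 : OddPoly 0) schurqSeries = schurqNegSeries := by
    ext n : 1; simp [schurqSeries, schurqNegSeries, PowerSeries.coeff_rescale]
  have h2 : PowerSeries.rescale (-1 : OddPoly 0) oddVarSeries = -oddVarSeries := by
    ext n : 1
    by_cases hn : Odd n
    · simp [oddVarSeries, PowerSeries.coeff_rescale, hn.neg_one_pow]
    · simp [oddVarSeries, PowerSeries.coeff_rescale, oddVar_of_not_odd hn]
  have h3 : PowerSeries.rescale (-1 : OddPoly 0)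
      (PowerSeries.X * PowerSeries.derivative (OddPoly 0) schurqSeries) =
      PowerSeries.X * PowerSeries.derivative (OddPoly 0) schurqNegSeries := by
    ext n : 1
    cases n with
    | zero => simp
    | succ n =>
      simp [PowerSeries.coeff_rescale, PowerSeries.coeff_succ_X_mul, PowerSeries.coeff_derivative,
        schurqSeries, schurqNegSeries]
      ring
  rw [h3, map_mul, map_mul, h1, h2] at h
  rw [h, map_ofNat]
  ring

/-- Because `p(u)` is odd, the logarithmic derivatives of `q(u)` and `q(-u)` cancel. -/
lemma schurqSeries_mul_neg : schurqSeries * schurqNegSeries = 1 := by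
  have h : schurqSeries * schurqNegSeries - 1 = 0 := by
    refine PowerSeries.eq_zero_of_X_mul_derivative (y := 0) (T := 0) (by simp) ?_ ?_
    · simp [schurqSeries, schurqNegSeries, schurq_zero]
    · simp only [map_sub, Derivation.leibniz, smul_eq_mul, Derivation.map_one_eq_zero, map_zero]
      linear_combination schurqNegSeries * X_mul_derivative_schurqSeries +
        schurqSeries * X_mul_derivative_schurqNegSeries
  exact sub_eq_zero.1 h

lemma sum_neg_one_pow_mul_schurq {n : ℕ} (hn : n ≠ 0) :
    ∑ i ∈ Finset.range (n + 1), (-1) ^ i * schurq (n - i) * schurq i = 0 := by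
  have h := congrArg (PowerSeries.coeff n) schurqSeries_mul_neg
  rw [mul_comm, PowerSeries.coeff_mul, Finset.Nat.sum_antidiagonal_eq_sum_range_succ_mk,
    PowerSeries.coeff_one, if_neg hn] at h
  rw [← h]
  refine Finset.sum_congr rfl fun i _ => ?_
  simp [schurqSeries, schurqNegSeries]
  ring

lemma sum_neg_one_pow_mul_nat_mul_schurq (n : ℕ) :
    ∑ i ∈ Finset.range (n + 1), (i : OddPoly 0) * ((-1) ^ i * schurq (n - i) * schurq i) =
      -2 * oddVar n := by
  have h : (PowerSeries.X * PowerSeries.derivative (OddPoly 0) schurqNegSeries) * schurqSeries =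
      PowerSeries.C (-2) * oddVarSeries := by
    rw [X_mul_derivative_schurqNegSeries, map_neg,
      show PowerSeries.C (2 : OddPoly 0) = 2 from rfl]
    linear_combination (-2 * oddVarSeries) * schurqSeries_mul_neg
  have h := congrArg (PowerSeries.coeff n) h
  rw [PowerSeries.coeff_mul, Finset.Nat.sum_antidiagonal_eq_sum_range_succ_mk,
    PowerSeries.coeff_C_mul] at h
  simp only [oddVarSeries, PowerSeries.coeff_mk] at h
  rw [← h]
  refine Finset.sum_congr rfl fun i _ => ?_
  cases i with
  | zero => simp
  | succ i =>
    rw [PowerSeries.coeff_succ_X_mul, PowerSeries.coeff_derivative]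
    simp [schurqSeries, schurqNegSeries]
    ring


/-! ### Vertex operators and their commutation relations. -/

/-- A linear property of the polynomials in the `p_k` that holds for `1` and is preserved by
multiplication with each `p_k` holds for all of them. -/
lemma OddPoly.mem_of_mul_oddVar {V : Submodule ℚ (OddPoly 0)} (h1 : 1 ∈ V)
    (hV : ∀ k, Odd k → ∀ f ∈ V, oddVar k * f ∈ V) (f : OddPoly 0) : f ∈ V := by
  induction f using MvPolynomial.induction_on with
  | C c => rw [← mul_one (C c), ← smul_eq_C_mul]; exact V.smul_mem c h1
  | add f g hf hg => exact V.add_mem hf hg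
  | mul_X f i hf => rw [mul_comm, ← oddVar_index]; exact hV _ i.2.1 f hf

/-- The substitution `p_k ↦ p_k - z^k`, i.e. the removal of a variable `z`. -/
def removeVariable : OddPoly 0 →ₐ[ℚ] Polynomial (OddPoly 0) :=
  aeval fun i => Polynomial.C (X i) - Polynomial.X ^ (i : ℕ)

lemma removeVariable_oddVar {k : ℕ} (hk : Odd k) :
    removeVariable (oddVar k) = Polynomial.C (oddVar k) - Polynomial.X ^ k := by
  simp [oddVar_of_odd hk, removeVariable]

/-- The linear map with `z^m ↦ q_{a+m}`. -/
def schurqEval (a : ℕ) : Polynomial (OddPoly 0) →ₗ[OddPoly 0] OddPoly 0 :=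
  Polynomial.lsum fun m => LinearMap.mulRight (OddPoly 0) (schurq (a + m))

lemma schurqEval_monomial (a m : ℕ) (c : OddPoly 0) :
    schurqEval a (Polynomial.monomial m c) = c * schurq (a + m) := by
  simp [schurqEval, Polynomial.lsum_apply]

lemma schurqEval_X_pow_mul (a k : ℕ) (g : Polynomial (OddPoly 0)) :
    schurqEval a (Polynomial.X ^ k * g) = schurqEval (a + k) g := by
  induction g using Polynomial.induction_on' with
  | add f g hf hg => rw [mul_add, map_add, map_add, hf, hg]
  | monomial m c =>
    rw [Polynomial.X_pow_mul_monomial, schurqEval_monomial, schurqEval_monomial]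
    congr 2; ring

lemma schurqEval_C_mul (a : ℕ) (c : OddPoly 0) (g : Polynomial (OddPoly 0)) :
    schurqEval a (Polynomial.C c * g) = c * schurqEval a g := by
  rw [← Polynomial.smul_eq_C_mul, map_smul, smul_eq_mul]

/-- The operator that adds a part `a` to a Schur `Q`-function. -/
def vertexOp (a : ℕ) : Module.End ℚ (OddPoly 0) :=
  (schurqEval a).restrictScalars ℚ ∘ₗ removeVariable.toLinearMap

lemma vertexOp_apply (a : ℕ) (f : OddPoly 0) : vertexOp a f = schurqEval a (removeVariable f) := rfl

lemma vertexOp_one (a : ℕ) : vertexOp a 1 = schurq a := by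
  rw [vertexOp_apply, map_one, ← Polynomial.monomial_zero_one, schurqEval_monomial]
  simp

lemma vertexOp_oddVar_mul (a : ℕ) {k : ℕ} (hk : Odd k) (f : OddPoly 0) :
    vertexOp a (oddVar k * f) = oddVar k * vertexOp a f - vertexOp (a + k) f := by
  simp only [vertexOp_apply, map_mul, removeVariable_oddVar hk, sub_mul, map_sub,
    schurqEval_C_mul, schurqEval_X_pow_mul]

lemma oddVar_mul_vertexOp (a : ℕ) {k : ℕ} (hk : Odd k) (f : OddPoly 0) :
    oddVar k * vertexOp a f = vertexOp a (oddVar k * f) + vertexOp (a + k) f := by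
  rw [vertexOp_oddVar_mul a hk, sub_add_cancel]

/-- Putting the removed variable `z` back recovers the original polynomials, so the recursion for an
added variable applies with `y = z`. -/
lemma removeVariable_schurq_succ (n : ℕ) :
    removeVariable (schurq (n + 1)) = Polynomial.C (schurq (n + 1)) -
      Polynomial.X * Polynomial.C (schurq n) - Polynomial.X * removeVariable (schurq n) := by
  have h := map_schurq_add_variable (φ := removeVariable)
    (ψ := (Algebra.ofId (OddPoly 0) (Polynomial (OddPoly 0))).restrictScalars ℚ)
    (y := Polynomial.X) (fun k hk => ?_) n
  · have h' (f : OddPoly 0) : ((Algebra.ofId (OddPoly 0)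
      (Polynomial (OddPoly 0))).restrictScalars ℚ) f = Polynomial.C f := rfl
    rw [h', h'] at h
    linear_combination -h
  · rw [removeVariable_oddVar hk, sub_add_cancel]
    rfl

lemma vertexOp_schurq_zero (a : ℕ) : vertexOp a (schurq 0) = schurq a := by
  rw [schurq_zero, vertexOp_one]

lemma vertexOp_schurq_succ (a n : ℕ) :
    vertexOp a (schurq (n + 1)) =
      schurq a * schurq (n + 1) - schurq (a + 1) * schurq n - vertexOp (a + 1) (schurq n) := by
  have h1 := schurqEval_X_pow_mul a 1
  simp only [pow_one] at h1
  have h2 (b : ℕ) (c : OddPoly 0) : schurqEval b (Polynomial.C c) = schurq b * c := by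
    rw [← Polynomial.monomial_zero_left, schurqEval_monomial, add_zero, mul_comm]
  rw [vertexOp_apply, removeVariable_schurq_succ, map_sub, map_sub, h1, h1, h2, h2]
  rfl

/-- The recursion of `vertexOp_schurq_succ` keeps `m` fixed, so with alternating signs it
telescopes. -/
lemma vertexOp_schurq_partialSum {m j : ℕ} (hj : j ≤ m) :
    (-1) ^ j * vertexOp (m - j) (schurq j) = (-1) ^ j * schurq (m - j) * schurq j +
      2 * ∑ i ∈ Finset.range j, (-1) ^ i * schurq (m - i) * schurq i := by
  induction j with
  | zero => simp [vertexOp_one, schurq_zero]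
  | succ j ih =>
    have ih := ih (by omega)
    rw [Finset.sum_range_succ, vertexOp_schurq_succ, show m - (j + 1) + 1 = m - j by omega]
    rw [pow_succ]
    linear_combination ih

lemma vertexOp_zero_schurq {m : ℕ} (hm : m ≠ 0) : vertexOp 0 (schurq m) = - schurq m := by
  have h := vertexOp_schurq_partialSum (le_refl m)
  have h' := sum_neg_one_pow_mul_schurq hm
  rw [Finset.sum_range_succ, Nat.sub_self, schurq_zero] at h'
  rw [Nat.sub_self, schurq_zero] at h
  have h2 : ((-1 : OddPoly 0) ^ m) * (-1) ^ m = 1 := by rw [← mul_pow]; simp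
  linear_combination (-1) ^ m * h + 2 * (-1) ^ m * h' - (vertexOp 0 (schurq m) + schurq m) * h2

/-- The recursion turns the sum for `(a, b + 1)` into minus the sum for `(a + 1, b)`, which leads
down to `b = 0`. -/
lemma vertexOp_schurq_anticomm (a b : ℕ) (h : a + b ≠ 0) :
    vertexOp a (schurq b) + vertexOp b (schurq a) = 0 := by
  induction b generalizing a with
  | zero => rw [vertexOp_schurq_zero, vertexOp_zero_schurq (by simpa using h), add_neg_cancel]
  | succ b ih =>
    have := ih (a + 1) (by omega)
    rw [vertexOp_schurq_succ] at this ⊢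
    linear_combination -this

/-- On `p_k f` the anticommutator for `(a, b)` is a combination of those for `(a, b)`, `(a + k, b)`
and `(a, b + k)` on `f`; hence all pairs are treated together, starting from `f = 1`. The pair `(0,
0)` is excluded because `B_0 1 = 1`. -/
lemma vertexOp_anticomm (a b : ℕ) (h : a + b ≠ 0) (f : OddPoly 0) :
    vertexOp a (vertexOp b f) = - vertexOp b (vertexOp a f) := by
  have key : f ∈ ⨅ (a : ℕ) (b : ℕ) (_ : a + b ≠ 0),
      LinearMap.ker (vertexOp a * vertexOp b + vertexOp b * vertexOp a) := by
    refine OddPoly.mem_of_mul_oddVar ?_ (fun k hk f hf => ?_) f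
    · simp only [Submodule.mem_iInf, LinearMap.mem_ker, LinearMap.add_apply, Module.End.mul_apply,
        vertexOp_one]
      exact vertexOp_schurq_anticomm
    · simp only [Submodule.mem_iInf, LinearMap.mem_ker, LinearMap.add_apply,
        Module.End.mul_apply] at hf ⊢
      intro a b hab
      simp only [vertexOp_oddVar_mul _ hk, map_sub]
      linear_combination oddVar k * hf a b hab - hf (a + k) b (by omega) - hf a (b + k) (by omega)
  simp only [Submodule.mem_iInf, LinearMap.mem_ker, LinearMap.add_apply,
        Module.End.mul_apply] at key
  exact eq_neg_of_add_eq_zero_left (key a b h)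

lemma vertexOp_self {a : ℕ} (h : a ≠ 0) (f : OddPoly 0) : vertexOp a (vertexOp a f) = 0 :=
  self_eq_neg.1 (vertexOp_anticomm a a (by omega) f)

/-! ### Power sums as combinations of `Q`-functions with at most two parts. -/

/-- With `c_i = (-1)^i q_{m-i} q_i`, adding up the partial sums gives `(2m + 1) ∑ c_i - 2 ∑ i c_i`;
the first sum is `0` and the second is `-2 p_m`. -/
lemma four_mul_oddVar {m : ℕ} (hm : m ≠ 0) :
    ∑ j ∈ Finset.range (m + 1), (-1) ^ j * vertexOp (m - j) (schurq j) = 4 * oddVar m := by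
  have h1 : ∀ n ≤ m + 1, ∑ j ∈ Finset.range n, (-1) ^ j * vertexOp (m - j) (schurq j) =
      ∑ i ∈ Finset.range n, (2 * (n : OddPoly 0) - 1) * ((-1) ^ i * schurq (m - i) * schurq i) -
      2 * ∑ i ∈ Finset.range n, (i : OddPoly 0) * ((-1) ^ i * schurq (m - i) * schurq i) := by
    intro n hn
    induction n with
    | zero => simp
    | succ n ih =>
      rw [Finset.sum_range_succ, ih (by omega), vertexOp_schurq_partialSum (by omega),
        ← Finset.mul_sum, ← Finset.mul_sum, Finset.sum_range_succ, Finset.sum_range_succ]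
      push_cast
      ring
  rw [h1 _ le_rfl, ← Finset.mul_sum, sum_neg_one_pow_mul_schurq hm,
    sum_neg_one_pow_mul_nat_mul_schurq]
  ring

/-- The power sums in terms of the Schur `Q`-functions of at most two parts. -/
lemma oddVar_eq_sum {m : ℕ} (hm : Odd m) :
    oddVar m = (2⁻¹ : ℚ) • vertexOp m 1 +
      ∑ j ∈ Finset.Ioo 0 m, ((-1) ^ j * 4⁻¹ : ℚ) • vertexOp (m - j) (vertexOp j 1) := by
  have h := four_mul_oddVar hm.pos.ne'
  -- For odd `m` the end terms `j = 0` and `j = m` are equal, as `B_0 q_m = -q_m`; together they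
  -- account for the coefficient `1/2`.
  rw [Finset.sum_range_succ, Nat.sub_self, vertexOp_zero_schurq hm.pos.ne', hm.neg_one_pow,
    ← Nat.Ico_zero_eq_range, ← Finset.Ioo_insert_left hm.pos, Finset.sum_insert (by simp),
    vertexOp_schurq_zero] at h
  have h2 : oddVar m = (4⁻¹ : ℚ) • (4 * oddVar m) := by
    rw [smul_eq_C_mul, ← mul_assoc, show (4 : OddPoly 0) = C 4 from (map_ofNat C 4).symm, ← C_mul]
    norm_num
  rw [h2, ← h, vertexOp_one]
  simp only [smul_add, Finset.smul_sum]
  have h3 : ∑ j ∈ Finset.Ioo 0 m, ((-1) ^ j * 4⁻¹ : ℚ) • vertexOp (m - j) (vertexOp j 1) =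
      ∑ j ∈ Finset.Ioo 0 m, (4⁻¹ : ℚ) • ((-1) ^ j * vertexOp (m - j) (schurq j)) := by
    refine Finset.sum_congr rfl fun j _ => ?_
    rw [vertexOp_one, mul_comm, mul_smul]
    congr 1
    rw [smul_eq_C_mul]
    simp
  rw [h3]
  simp only [pow_zero, one_mul, Nat.sub_zero, neg_mul, neg_neg]
  rw [add_right_comm, ← add_smul]
  norm_num


/-! ### Weights, and linear independence by counting. -/

section Graded

variable {σ τ ι : Type*}

/-- A spanning family of weighted homogeneous polynomials that can be injected into the monomials,
with weights preserved, is linearly independent. -/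
lemma MvPolynomial.linearIndependent_of_span_of_weight_injection (w : σ → ℕ) {d : ι → ℕ}
    {b : ι → MvPolynomial σ ℚ} (hb : ∀ i, IsWeightedHomogeneous w (b i) (d i))
    (hspan : ⊤ ≤ Submodule.span ℚ (Set.range b)) {ψ : ι → σ →₀ ℕ} (hψ : Function.Injective ψ)
    (hw : ∀ i, Finsupp.weight w (ψ i) = d i) (hfin : ∀ n, {i | d i = n}.Finite) :
    LinearIndependent ℚ b := by
  classical
  have comp (c : ι →₀ ℚ) (n : ℕ) : weightedHomogeneousComponent w n
      (Finsupp.linearCombination ℚ b c) =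
      Finsupp.linearCombination ℚ b (c.filter fun i => d i = n) := by
    induction c using Finsupp.induction_linear with
    | zero => rw [map_zero, map_zero, Finsupp.filter_zero, map_zero]
    | add c c' h h' => rw [map_add, map_add, h, h', Finsupp.filter_add, map_add]
    | single i a =>
      rw [Finsupp.linearCombination_single, map_smul]
      by_cases h : d i = n
      · rw [Finsupp.filter_single_of_pos (fun i => d i = n) h, Finsupp.linearCombination_single, ← h,
          (hb i).weightedHomogeneousComponent_same]
      · rw [Finsupp.filter_single_of_neg (fun i => d i = n) h, map_zero,
          (hb i).weightedHomogeneousComponent_ne _ (Ne.symm h), smul_zero]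
  have restr (c : ι →₀ ℚ) (n : ℕ) : Finsupp.linearCombination ℚ b (c.filter fun i => d i = n) =
      Finsupp.linearCombination ℚ (fun i : {i // d i = n} => b i)
        (c.subtypeDomain fun i => d i = n) := by
    rw [Finsupp.linearCombination_apply, Finsupp.linearCombination_apply, Finsupp.sum, Finsupp.sum,
      Finsupp.support_subtypeDomain, Finsupp.support_filter, ← Finset.sum_subtype_eq_sum_filter]
    refine Finset.sum_congr rfl fun j hj => ?_
    rw [Finsupp.filter_apply_pos (fun j => d j = n) _ j.2, Finsupp.subtypeDomain_apply]
  have indep (n : ℕ) : LinearIndependent ℚ fun i : {i // d i = n} => b i := by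
    let W := weightedHomogeneousSubmodule ℚ w n
    have : Finite {i // d i = n} := hfin n
    have := Fintype.ofFinite {i // d i = n}
    let b' : {i // d i = n} → W := fun i => ⟨b i, by have := hb i; rwa [i.2] at this⟩
    have hspan' : ⊤ ≤ Submodule.span ℚ (Set.range b') := by
      rintro ⟨f, hf⟩ -
      have hf' : f ∈ Submodule.span ℚ (Set.range b) := hspan trivial
      rw [Finsupp.mem_span_range_iff_exists_finsupp] at hf'
      obtain ⟨c, hc⟩ := hf'
      have h1 := comp c n
      rw [Finsupp.linearCombination_apply, hc] at h1
      rw [IsWeightedHomogeneous.weightedHomogeneousComponent_same hf] at h1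
      rw [restr] at h1
      rw [Finsupp.mem_span_range_iff_exists_finsupp]
      exact ⟨c.subtypeDomain fun i => d i = n, Subtype.ext
        ((Finsupp.apply_linearCombination ℚ W.subtype b' _).trans h1.symm)⟩
    -- The monomials `ψ i` are independent in the weight space, so its dimension is at least the
    -- number of indices of weight `n`; a spanning family of that size is independent.
    let e : {i // d i = n} → W := fun i =>
      ⟨monomial (ψ i) 1, isWeightedHomogeneous_monomial _ _ _ ((hw i).trans i.2)⟩
    have he : LinearIndependent ℚ e := by
      have h1 := (basisMonomials σ ℚ).linearIndependent.comp (fun i : {i // d i = n} => ψ i)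
        (hψ.comp Subtype.val_injective)
      rw [coe_basisMonomials] at h1
      exact LinearIndependent.of_comp W.subtype h1
    have : Module.Finite ℚ W := ⟨⟨Finset.univ.image b', by
      rw [Finset.coe_image, Finset.coe_univ, Set.image_univ]; exact top_le_iff.1 hspan'⟩⟩
    exact (linearIndependent_of_top_le_span_of_card_le_finrank hspan'
      he.fintype_card_le_finrank).map' W.subtype (by simp)
  rw [linearIndependent_iff]
  intro c hc
  ext i
  have h1 := comp c (d i)
  rw [hc, map_zero] at h1
  have h2 := linearIndependent_iff.1 (indep (d i)) (c.subtypeDomain fun j => d j = d i) (by rw [← restr, ← h1])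
  exact DFunLike.congr_fun h2 ⟨i, rfl⟩

lemma MvPolynomial.IsWeightedHomogeneous.map_linear {v : σ → ℕ} {w : τ → ℕ} {a : ℕ}
    {T : MvPolynomial σ ℚ →ₗ[ℚ] MvPolynomial τ ℚ}
    (hT1 : IsWeightedHomogeneous w (T 1) a)
    (hT : ∀ f d, IsWeightedHomogeneous v f d → IsWeightedHomogeneous w (T f) (d + a) →
      ∀ i, IsWeightedHomogeneous w (T (f * X i)) (d + v i + a))
    {f : MvPolynomial σ ℚ} {d : ℕ} (hf : IsWeightedHomogeneous v f d) :
    IsWeightedHomogeneous w (T f) (d + a) := by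
  have key (s : σ →₀ ℕ) (c : ℚ) : ∃ d, IsWeightedHomogeneous v (monomial s c) d ∧
      IsWeightedHomogeneous w (T (monomial s c)) (d + a) := by
    refine induction_on_monomial (motive := fun p => ∃ d, IsWeightedHomogeneous v p d ∧
      IsWeightedHomogeneous w (T p) (d + a)) (fun c => ⟨0, isWeightedHomogeneous_C v c, ?_⟩) ?_ s c
    · rw [← mul_one (C c), ← smul_eq_C_mul, map_smul, zero_add, smul_eq_C_mul]
      exact hT1.C_mul c
    · rintro p i ⟨d, h1, h2⟩
      exact ⟨d + v i, h1.mul (isWeightedHomogeneous_X ℚ v i), hT p d h1 h2 i⟩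
  induction hf using IsWeightedHomogeneous.induction_on with
  | zero => rw [map_zero]; exact isWeightedHomogeneous_zero ℚ w _
  | add p q _ _ hp hq => rw [map_add]; exact hp.add hq
  | monomial s c hr =>
    by_cases hc : c = 0
    · rw [hc, map_zero, map_zero]; exact isWeightedHomogeneous_zero ℚ w _
    · obtain ⟨e, h1, h2⟩ := key s c
      rwa [h1.inj_right (by simpa using hc) (isWeightedHomogeneous_monomial v s c hr)] at h2

end Graded

/-- The degree of the variable `p_j`, which is `j`. -/
abbrev oddWeight (r : ℕ) : OddIndex r → ℕ := Subtype.val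

lemma isWeightedHomogeneous_oddVar (k : ℕ) : IsWeightedHomogeneous (oddWeight 0) (oddVar k) k := by
  by_cases hk : Odd k
  · rw [oddVar_of_odd hk]
    exact isWeightedHomogeneous_X ℚ (oddWeight 0) ⟨k, odd_index_zero hk⟩
  · rw [oddVar_of_not_odd hk]
    exact isWeightedHomogeneous_zero ℚ _ _

lemma isWeightedHomogeneous_schurq (n : ℕ) :
    IsWeightedHomogeneous (oddWeight 0) (schurq n) n := by
  induction n using Nat.strong_induction_on with
  | _ n ih =>
    cases n with
    | zero => rw [schurq_zero]; exact isWeightedHomogeneous_one ℚ _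
    | succ n =>
      rw [schurq, smul_eq_C_mul]
      refine IsWeightedHomogeneous.C_mul (IsWeightedHomogeneous.sum _ _ _ fun k _ => ?_) _
      have := (isWeightedHomogeneous_oddVar (k + 1)).mul (ih (n - k) (by omega))
      rwa [show (k : ℕ) + 1 + (n - k) = n + 1 by omega] at this

/-- Commuting with `p_k` raises `a` to `a + k`, so the induction over monomials carries all `a` at
once. -/
lemma isWeightedHomogeneous_vertexOp {f : OddPoly 0} {d : ℕ}
    (hf : IsWeightedHomogeneous (oddWeight 0) f d) (a : ℕ) :
    IsWeightedHomogeneous (oddWeight 0) (vertexOp a f) (d + a) := by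
  have key (s : OddIndex 0 →₀ ℕ) (c : ℚ) :
      ∃ d, IsWeightedHomogeneous (oddWeight 0) (monomial s c) d ∧
      ∀ a, IsWeightedHomogeneous (oddWeight 0) (vertexOp a (monomial s c)) (d + a) := by
    refine induction_on_monomial (motive := fun p => ∃ d, IsWeightedHomogeneous (oddWeight 0) p d ∧
      ∀ a, IsWeightedHomogeneous (oddWeight 0) (vertexOp a p) (d + a))
      (fun c => ⟨0, isWeightedHomogeneous_C _ c, fun a => ?_⟩) ?_ s c
    · rw [← mul_one (C c), ← smul_eq_C_mul, map_smul, zero_add, smul_eq_C_mul, vertexOp_one]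
      exact (isWeightedHomogeneous_schurq a).C_mul c
    · rintro p i ⟨d, h1, h2⟩
      refine ⟨d + i, h1.mul (isWeightedHomogeneous_X ℚ _ i), fun a => ?_⟩
      rw [mul_comm, ← oddVar_index, vertexOp_oddVar_mul a i.2.1]
      refine IsWeightedHomogeneous.sub ?_ ?_
      · have := (isWeightedHomogeneous_oddVar i).mul (h2 a)
        rwa [show (i : ℕ) + (d + a) = d + i + a by ring] at this
      · have := h2 (a + i)
        rwa [show d + (a + (i : ℕ)) = d + i + a by ring] at this
  induction hf using IsWeightedHomogeneous.induction_on with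
  | zero => rw [map_zero]; exact isWeightedHomogeneous_zero ℚ _ _
  | add p q _ _ hp hq => rw [map_add]; exact hp.add hq
  | monomial s c hr =>
    by_cases hc : c = 0
    · rw [hc, map_zero, map_zero]; exact isWeightedHomogeneous_zero ℚ _ _
    · obtain ⟨e, h1, h2⟩ := key s c
      have h2 := h2 a
      rwa [h1.inj_right (by simpa using hc) (isWeightedHomogeneous_monomial _ s c hr)] at h2

/-! ### `Q`-functions as words in the operators, and their reduction. -/

/-- The Schur `Q`-function of a sequence of parts, as a polynomial in the `p_k`. -/
def schurWord (l : List ℕ) : OddPoly 0 := l.foldr (fun a f => vertexOp a f) 1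

lemma schurWord_nil : schurWord [] = 1 := rfl

lemma schurWord_cons (a : ℕ) (l : List ℕ) : schurWord (a :: l) = vertexOp a (schurWord l) := rfl

lemma isWeightedHomogeneous_schurWord (l : List ℕ) :
    IsWeightedHomogeneous (oddWeight 0) (schurWord l) l.sum := by
  induction l with
  | nil => exact isWeightedHomogeneous_one ℚ _
  | cons a l ih =>
    rw [schurWord_cons, List.sum_cons, add_comm]
    exact isWeightedHomogeneous_vertexOp ih a

/-- The substitution `p_j ↦ 0` for `r ∣ j`. -/
def reducePoly (r : ℕ) : OddPoly 0 →ₐ[ℚ] OddPoly r :=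
  aeval fun i => if h : r ∣ i then 0 else X ⟨i, i.2.1, h⟩

lemma reducePoly_oddVar_of_dvd {r k : ℕ} (h : r ∣ k) : reducePoly r (oddVar k) = 0 := by
  by_cases hk : Odd k
  · simp [oddVar_of_odd hk, reducePoly, h]
  · simp [oddVar_of_not_odd hk]

lemma reducePoly_oddVar {r k : ℕ} (hk : Odd k) (h : ¬ r ∣ k) :
    reducePoly r (oddVar k) = X ⟨k, hk, h⟩ := by
  simp [oddVar_of_odd hk, reducePoly, h]

lemma reducePoly_surjective (r : ℕ) : Function.Surjective (reducePoly r) := by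
  intro f
  induction f using MvPolynomial.induction_on with
  | C c => exact ⟨C c, by simp [reducePoly]⟩
  | add f g hf hg =>
    obtain ⟨f, rfl⟩ := hf
    obtain ⟨g, rfl⟩ := hg
    exact ⟨f + g, map_add _ _ _⟩
  | mul_X f i hf =>
    obtain ⟨f, rfl⟩ := hf
    exact ⟨f * oddVar i, by rw [map_mul, reducePoly_oddVar i.2.1 i.2.2]⟩

lemma reducePoly_zero : reducePoly 0 = AlgHom.id ℚ (OddPoly 0) := by
  refine MvPolynomial.algHom_ext fun i => ?_
  rw [← oddVar_index, reducePoly_oddVar i.2.1 i.2.2, AlgHom.id_apply, oddVar_index]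

lemma isWeightedHomogeneous_reducePoly {r : ℕ} {f : OddPoly 0} {d : ℕ}
    (hf : IsWeightedHomogeneous (oddWeight 0) f d) :
    IsWeightedHomogeneous (oddWeight r) (reducePoly r f) d := by
  refine IsWeightedHomogeneous.map_linear (a := 0) (T := (reducePoly r).toLinearMap)
    ?_ (fun f d _ h i => ?_) hf
  · simpa using isWeightedHomogeneous_one ℚ (oddWeight r)
  · simp only [AlgHom.toLinearMap_apply, map_mul] at h ⊢
    refine h.mul ?_
    rw [← oddVar_index]
    by_cases hi : r ∣ i
    · rw [reducePoly_oddVar_of_dvd hi]; exact isWeightedHomogeneous_zero ℚ _ _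
    · rw [reducePoly_oddVar i.2.1 hi]; exact isWeightedHomogeneous_X ℚ (oddWeight r) _


/-! ### Glaisher's injection of strict partitions into monomials. -/

/-- The odd part of `j`. -/
def oddPartIndex {r : ℕ} (j : {j : ℕ // ¬ r ∣ j}) : OddIndex r :=
  ⟨ordCompl[2] j.1, by
    have hj : j.1 ≠ 0 := fun h => j.2 (h ▸ dvd_zero r)
    exact ⟨Nat.not_even_iff_odd.1 fun h => Nat.not_dvd_ordCompl Nat.prime_two hj h.two_dvd,
      fun h => j.2 (h.trans (Nat.ordCompl_dvd _ _))⟩⟩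

/-- The monomial in the odd variables with one factor `p_m ^ (2 ^ k)` for each element `2 ^ k * m`
(`m` odd) of a finite set. -/
def oddExponents {r : ℕ} (T : Finset {j : ℕ // ¬ r ∣ j}) : OddIndex r →₀ ℕ :=
  ∑ j ∈ T, Finsupp.single (oddPartIndex j) (ordProj[2] j.1)

lemma weight_oddExponents {r : ℕ} (T : Finset {j : ℕ // ¬ r ∣ j}) :
    Finsupp.weight (oddWeight r) (oddExponents T) = ∑ j ∈ T, j.1 := by
  rw [oddExponents, map_sum]
  refine Finset.sum_congr rfl fun j _ => ?_
  rw [Finsupp.weight_single, smul_eq_mul]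
  exact Nat.ordProj_mul_ordCompl_eq_self _ _

/-- The exponent of `p_m` is a sum of distinct powers of `2`; its binary expansion tells which `2^k
m` belong to the set. -/
lemma oddExponents_injective (r : ℕ) : Function.Injective (oddExponents (r := r)) := by
  classical
  have hinj {j j' : {j : ℕ // ¬ r ∣ j}} (h : oddPartIndex j = oddPartIndex j')
      (h' : j.1.factorization 2 = j'.1.factorization 2) : j = j' := by
    have h1 : ordCompl[2] j.1 = ordCompl[2] j'.1 := congrArg Subtype.val h
    refine Subtype.ext ?_
    rw [← Nat.ordProj_mul_ordCompl_eq_self j.1 2, ← Nat.ordProj_mul_ordCompl_eq_self j'.1 2, h1, h']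
  have happ (T : Finset {j : ℕ // ¬ r ∣ j}) (m : OddIndex r) : oddExponents T m =
      ∑ k ∈ (T.filter fun j => oddPartIndex j = m).image (fun j => j.1.factorization 2), 2 ^ k := by
    rw [Finset.sum_image, oddExponents, Finsupp.finsetSum_apply, Finset.sum_filter]
    · refine Finset.sum_congr rfl fun j _ => ?_
      rw [Finsupp.single_apply]
    · intro j hj j' hj' h
      exact hinj (((Finset.mem_filter.1 hj).2).trans (Finset.mem_filter.1 hj').2.symm) h
  have hsub {T T' : Finset {j : ℕ // ¬ r ∣ j}} (h : oddExponents T = oddExponents T') : T ⊆ T' := by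
    intro j hj
    have h1 := DFunLike.congr_fun h (oddPartIndex j)
    rw [happ, happ] at h1
    have h2 := Finset.geomSum_injective le_rfl h1
    have h3 : j.1.factorization 2 ∈ (T.filter fun i => oddPartIndex i = oddPartIndex j).image
        (fun i => i.1.factorization 2) :=
      Finset.mem_image_of_mem _ (Finset.mem_filter.2 ⟨hj, rfl⟩)
    rw [h2] at h3
    obtain ⟨i, hi, hi'⟩ := Finset.mem_image.1 h3
    rw [Finset.mem_filter] at hi
    rw [← hinj hi.2 hi']
    exact hi.1
  exact fun T T' h => (hsub h).antisymm (hsub h.symm)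

namespace StrictPartition

lemma toFinset_injective : Function.Injective fun μ : StrictPartition => μ.parts.toFinset := by
  intro μ ν h
  refine StrictPartition.ext ?_
  have hn (μ : StrictPartition) : μ.parts.Nodup := μ.strict.imp fun h => (ne_of_gt h)
  exact (List.perm_of_nodup_nodup_toFinset_eq (hn μ) (hn ν) h).eq_of_pairwise
    (fun _ _ _ _ h h' => absurd h (not_lt_of_gt h')) μ.strict ν.strict

lemma finite_setOf_sum_eq (n : ℕ) : {μ : StrictPartition | μ.parts.sum = n}.Finite := by
  refine Set.Finite.of_finite_image (f := fun μ : StrictPartition => μ.parts.toFinset) ?_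
    toFinset_injective.injOn
  refine ((Finset.range (n + 1)).powerset.finite_toSet).subset ?_
  rintro _ ⟨μ, rfl, rfl⟩
  simp only [Finset.coe_powerset, Set.mem_preimage, Set.mem_powerset_iff, Finset.coe_subset]
  intro k hk
  rw [Finset.mem_range, Nat.lt_succ_iff]
  exact List.single_le_sum (fun _ _ => Nat.zero_le _) k (List.mem_toFinset.1 hk)

end StrictPartition

/-- The strict partitions without parts divisible by `r`. -/
abbrev ReducedStrict (r : ℕ) : Type := {μ : StrictPartition // ∀ k ∈ μ.parts, ¬ r ∣ k}

lemma linearIndependent_reducePoly_of_span {r : ℕ}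
    (h : ⊤ ≤ Submodule.span ℚ
      (Set.range fun μ : ReducedStrict r => reducePoly r (schurWord μ.1.parts))) :
    LinearIndependent ℚ fun μ : ReducedStrict r => reducePoly r (schurWord μ.1.parts) := by
  have hT (μ : ReducedStrict r) :
      (μ.1.parts.toFinset.subtype fun j => ¬ r ∣ j).map (Function.Embedding.subtype _) =
        μ.1.parts.toFinset := by
    rw [Finset.subtype_map, Finset.filter_true_of_mem]
    exact fun k hk => μ.2 k (List.mem_toFinset.1 hk)
  refine MvPolynomial.linearIndependent_of_span_of_weight_injection (oddWeight r)
    (d := fun μ => μ.1.parts.sum)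
    (ψ := fun μ => oddExponents (μ.1.parts.toFinset.subtype fun j => ¬ r ∣ j))
    (fun μ => isWeightedHomogeneous_reducePoly (isWeightedHomogeneous_schurWord _)) h ?_ ?_ ?_
  · intro μ ν hμν
    refine Subtype.ext (StrictPartition.toFinset_injective ?_)
    change μ.1.parts.toFinset = ν.1.parts.toFinset
    rw [← hT μ, ← hT ν, oddExponents_injective r hμν]
  · intro μ
    rw [weight_oddExponents]
    have h1 := Finset.sum_map (μ.1.parts.toFinset.subtype fun j => ¬ r ∣ j)
      (Function.Embedding.subtype _) (fun j => j)
    rw [hT, List.sum_toFinset _ (μ.1.strict.imp fun h => ne_of_gt h), List.map_id'] at h1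
    exact h1.symm
  · intro n
    exact (StrictPartition.finite_setOf_sum_eq n).preimage Subtype.val_injective.injOn

/-! ### Sorting words; the `Q`-functions form a basis. -/

/-- Sorting the parts of a sequence changes the Schur `Q`-function by a sign that depends only on
the permutation. -/
lemma schurWord_perm {l l' : List ℕ} (h : l.Perm l') (hl : ∀ k ∈ l, 0 < k) {r : ℕ} (hr : 0 < r) :
    ∃ ε : ℚ, schurWord l = ε • schurWord l' ∧
      schurWord (l.map (r * ·)) = ε • schurWord (l'.map (r * ·)) := by
  induction h with
  | nil => exact ⟨1, by simp⟩
  | cons a _ ih =>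
    obtain ⟨ε, h1, h2⟩ := ih fun k hk => hl k (List.mem_cons_of_mem _ hk)
    exact ⟨ε, by rw [schurWord_cons, h1, map_smul, schurWord_cons],
      by rw [List.map_cons, schurWord_cons, h2, map_smul, List.map_cons, schurWord_cons]⟩
  | swap a b l =>
    have ha : 0 < a := hl a (by simp)
    refine ⟨-1, ?_, ?_⟩
    · simp only [schurWord_cons]
      rw [vertexOp_anticomm _ _ (by omega), neg_one_smul]
    · simp only [List.map_cons, schurWord_cons]
      rw [vertexOp_anticomm _ _ (by positivity), neg_one_smul]
  | trans h12 _ ih1 ih2 =>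
    obtain ⟨ε, h1, h2⟩ := ih1 hl
    obtain ⟨ε', h1', h2'⟩ := ih2 fun k hk => hl k (h12.mem_iff.2 hk)
    exact ⟨ε * ε', by rw [h1, h1', mul_smul], by rw [h2, h2', mul_smul]⟩

lemma vertexOp_schurWord_of_mem {a : ℕ} (ha : 0 < a) {l : List ℕ} (h : a ∈ l) :
    vertexOp a (schurWord l) = 0 := by
  induction l with
  | nil => simp at h
  | cons b l ih =>
    rw [schurWord_cons]
    rcases List.mem_cons.1 h with rfl | h
    · exact vertexOp_self ha.ne' _
    · rw [vertexOp_anticomm _ _ (by omega), ih h, map_zero, neg_zero]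

lemma schurWord_of_not_nodup {l : List ℕ} (hl : ∀ k ∈ l, 0 < k) (h : ¬ l.Nodup) :
    schurWord l = 0 := by
  induction l with
  | nil => simp at h
  | cons a l ih =>
    rw [schurWord_cons]
    by_cases ha : a ∈ l
    · exact vertexOp_schurWord_of_mem (hl a (by simp)) ha
    · rw [ih (fun k hk => hl k (List.mem_cons_of_mem _ hk))
        (fun hn => h (List.nodup_cons.2 ⟨ha, hn⟩)), map_zero]

lemma StrictPartition.exists_perm {l : List ℕ} (hl : ∀ k ∈ l, 0 < k) (h : l.Nodup) :
    ∃ μ : StrictPartition, l.Perm μ.parts := by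
  have hp : (l.mergeSort (fun a b => decide (b ≤ a))).Perm l := List.mergeSort_perm _ _
  refine ⟨⟨l.mergeSort (fun a b => decide (b ≤ a)), ?_, fun k hk => hl k (hp.mem_iff.1 hk)⟩,
    hp.symm⟩
  have h1 := List.pairwise_mergeSort (le := fun a b : ℕ => decide (b ≤ a))
    (fun a b c h h' => by simp at h h' ⊢; omega) (fun a b => by simp; omega) l
  have h2 : (l.mergeSort (fun a b => decide (b ≤ a))).Nodup := hp.nodup_iff.2 h
  exact (h1.and h2).imp fun h => by
    have := h.1
    have := h.2
    simp at *
    omega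

/-- The sequences of positive parts, up to sign, give the same functions as the strict partitions. -/
lemma schurWord_mem_span {l : List ℕ} {P : ℕ → Prop} (hl : ∀ k ∈ l, 0 < k) (hP : ∀ k ∈ l, P k) :
    schurWord l ∈ Submodule.span ℚ (Set.range fun μ : {μ : StrictPartition // ∀ k ∈ μ.parts, P k} =>
      schurWord μ.1.parts) := by
  by_cases h : l.Nodup
  · obtain ⟨μ, hμ⟩ := StrictPartition.exists_perm hl h
    obtain ⟨ε, h1, -⟩ := schurWord_perm hμ hl one_pos
    rw [h1]
    exact Submodule.smul_mem _ _ (Submodule.subset_span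
      ⟨⟨μ, fun k hk => hP k (hμ.mem_iff.2 hk)⟩, rfl⟩)
  · rw [schurWord_of_not_nodup hl h]
    exact Submodule.zero_mem _

/-- The span of the Schur `Q`-functions. -/
lemma span_schurWord (f : OddPoly 0) :
    f ∈ Submodule.span ℚ {g | ∃ l : List ℕ, (∀ k ∈ l, 0 < k) ∧ schurWord l = g} := by
  set V := Submodule.span ℚ {g | ∃ l : List ℕ, (∀ k ∈ l, 0 < k) ∧ schurWord l = g}
  have hB {a : ℕ} (ha : 0 < a) {g : OddPoly 0} (hg : g ∈ V) : vertexOp a g ∈ V := by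
    refine (Submodule.span_le (p := V.comap (vertexOp a))).2 ?_ hg
    rintro _ ⟨l, hl, rfl⟩
    refine Submodule.subset_span ⟨a :: l, ?_, rfl⟩
    simpa [ha] using hl
  have h1 : (1 : OddPoly 0) ∈ V := Submodule.subset_span ⟨[], by simp, rfl⟩
  have hp {k : ℕ} (hk : Odd k) : oddVar k ∈ V := by
    rw [oddVar_eq_sum hk]
    refine V.add_mem (V.smul_mem _ (hB hk.pos h1)) (V.sum_mem fun j hj => V.smul_mem _ ?_)
    rw [Finset.mem_Ioo] at hj
    exact hB (by omega) (hB hj.1 h1)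
  refine OddPoly.mem_of_mul_oddVar h1 (fun k hk f hf => ?_) f
  refine (Submodule.span_le (p := V.comap (LinearMap.mulLeft ℚ (oddVar k)))).2 ?_ hf
  rintro _ ⟨l, hl, rfl⟩
  simp only [Submodule.comap_coe, Set.mem_preimage, LinearMap.mulLeft_apply, SetLike.mem_coe]
  induction l with
  | nil => rw [schurWord_nil, mul_one]; exact hp hk
  | cons a l ih =>
    -- Moving `p_k` past a part costs one word in which that part is raised by `k`.
    rw [schurWord_cons, oddVar_mul_vertexOp a hk]
    have hl' : ∀ k ∈ l, 0 < k := fun k hk => hl k (List.mem_cons_of_mem _ hk)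
    exact V.add_mem (hB (hl a (by simp)) (ih hl'))
      (hB (Nat.add_pos_left (hl a (by simp)) k) (Submodule.subset_span ⟨l, hl', rfl⟩))

lemma span_schurWord_strict : ⊤ ≤ Submodule.span ℚ
    (Set.range fun μ : ReducedStrict 0 => schurWord μ.1.parts) := by
  intro f _
  refine (Submodule.span_le.2 ?_) (span_schurWord f)
  rintro _ ⟨l, hl, rfl⟩
  exact schurWord_mem_span hl fun k hk h => by
    have := hl k hk
    rw [zero_dvd_iff] at h
    omega

lemma linearIndependent_schurWord :
    LinearIndependent ℚ fun μ : ReducedStrict 0 => schurWord μ.1.parts := by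
  have h := linearIndependent_reducePoly_of_span (r := 0)
  simp only [reducePoly_zero, AlgHom.id_apply] at h
  exact h span_schurWord_strict

/-- The basis of Schur `Q`-functions. -/
def schurBasis : Module.Basis (ReducedStrict 0) ℚ (OddPoly 0) :=
  Module.Basis.mk linearIndependent_schurWord span_schurWord_strict

/-! ### Dilation of the parts by `r`. -/

/-- The linear map that multiplies the parts of all Schur `Q`-functions by `r`. -/
def dilate (r : ℕ) : OddPoly 0 →ₗ[ℚ] OddPoly 0 :=
  schurBasis.constr ℚ fun μ => schurWord (μ.1.parts.map (r * ·))

/-- The definition covers only sorted words; it extends to all of them because sorting a word and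
sorting its dilation produce the same sign. -/
lemma dilate_schurWord {r : ℕ} (hr : 0 < r) {l : List ℕ} (hl : ∀ k ∈ l, 0 < k) :
    dilate r (schurWord l) = schurWord (l.map (r * ·)) := by
  by_cases h : l.Nodup
  · obtain ⟨μ, hμ⟩ := StrictPartition.exists_perm hl h
    obtain ⟨ε, h1, h2⟩ := schurWord_perm hμ hl hr
    have hb : schurWord μ.parts = schurBasis ⟨μ, fun k hk h => by
        have := μ.pos k hk
        rw [zero_dvd_iff] at h
        omega⟩ := by
      rw [schurBasis, Module.Basis.mk_apply]
    rw [h1, map_smul, h2, hb, dilate, Module.Basis.constr_basis]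
  · rw [schurWord_of_not_nodup hl h, map_zero, schurWord_of_not_nodup]
    · simp only [List.mem_map]
      rintro _ ⟨k, hk, rfl⟩
      exact mul_pos hr (hl k hk)
    · rwa [List.nodup_map_iff (mul_right_injective₀ hr.ne')]

lemma dilate_one {r : ℕ} (hr : 0 < r) : dilate r 1 = 1 :=
  dilate_schurWord hr (l := []) (by simp)

lemma dilate_vertexOp {r : ℕ} (hr : 0 < r) {a : ℕ} (ha : 0 < a) (f : OddPoly 0) :
    dilate r (vertexOp a f) = vertexOp (r * a) (dilate r f) := by
  refine (Submodule.span_le (p := LinearMap.eqLocus (dilate r ∘ₗ vertexOp a)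
    (vertexOp (r * a) ∘ₗ dilate r))).2 ?_ (span_schurWord f)
  rintro _ ⟨l, hl, rfl⟩
  simp only [SetLike.mem_coe, LinearMap.mem_eqLocus, LinearMap.comp_apply]
  rw [← schurWord_cons, dilate_schurWord hr hl, dilate_schurWord hr (by simpa [ha] using hl)]
  rfl

/-- The part of the expansion of `p_m` into Schur `Q`-functions with parts not divisible by `r`, as
an operator. -/
def nondivPart (r m : ℕ) : Module.End ℚ (OddPoly 0) :=
  ∑ j ∈ (Finset.Ioo 0 m).filter (fun j => ¬ r ∣ j),
    ((-1) ^ j * 4⁻¹ : ℚ) • (vertexOp (m - j) * vertexOp j)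

/-- Each term of `nondivPart` is a product of two operators, so the two signs cancel. -/
lemma nondivPart_vertexOp {a : ℕ} (ha : 0 < a) (r m : ℕ) (f : OddPoly 0) :
    nondivPart r m (vertexOp a f) = vertexOp a (nondivPart r m f) := by
  simp only [nondivPart, LinearMap.sum_apply, map_sum, LinearMap.smul_apply, map_smul,
    Module.End.mul_apply]
  refine Finset.sum_congr rfl fun j _ => ?_
  rw [vertexOp_anticomm j a (by omega), map_neg, vertexOp_anticomm _ a (by omega), neg_neg]

/-- The terms with `r ∣ j` in the expansion of `p_{rk}` are the dilated terms of `p_k`; the signs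
agree because `r` is odd. -/
lemma oddVar_eq_dilate_add {r k : ℕ} (hr : Odd r) (hk : Odd k) :
    oddVar (r * k) = dilate r (oddVar k) + nondivPart r (r * k) 1 := by
  have hr0 := hr.pos
  rw [oddVar_eq_sum (hr.mul hk), oddVar_eq_sum hk, nondivPart,
    ← Finset.sum_filter_add_sum_filter_not _ (fun j => r ∣ j)]
  simp only [map_add, map_sum, map_smul, LinearMap.sum_apply, LinearMap.smul_apply,
    Module.End.mul_apply, ← add_assoc]
  congr 1
  rw [dilate_vertexOp hr0 hk.pos, dilate_one hr0]
  congr 1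
  symm
  refine Finset.sum_bij (fun j _ => r * j) ?_ ?_ ?_ ?_
  · intro j hj
    rw [Finset.mem_Ioo] at hj
    rw [Finset.mem_filter, Finset.mem_Ioo]
    exact ⟨⟨mul_pos hr0 hj.1, Nat.mul_lt_mul_of_pos_left hj.2 hr0⟩, dvd_mul_right _ _⟩
  · exact fun i _ j _ h => mul_right_injective₀ hr0.ne' h
  · intro j hj
    rw [Finset.mem_filter, Finset.mem_Ioo] at hj
    obtain ⟨⟨h1, h2⟩, i, rfl⟩ := hj
    exact ⟨i, Finset.mem_Ioo.2 ⟨pos_of_mul_pos_right h1 hr0.le, lt_of_mul_lt_mul_left h2 hr0.le⟩,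
      rfl⟩
  · intro j hj
    rw [Finset.mem_Ioo] at hj
    rw [dilate_vertexOp hr0 (by omega), dilate_vertexOp hr0 hj.1, dilate_one hr0, Nat.mul_sub,
      pow_mul, hr.neg_one_pow]

/-- Induction along a word: raising `ra` by `rk` is the dilation of raising `a` by `k`, and
`nondivPart` passes through every part. -/
lemma oddVar_mul_dilate {r k : ℕ} (hr : Odd r) (hk : Odd k) (f : OddPoly 0) :
    oddVar (r * k) * dilate r f = dilate r (oddVar k * f) + nondivPart r (r * k) (dilate r f) := by
  have hr0 := hr.pos
  refine (Submodule.span_le (p := LinearMap.eqLocus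
    (LinearMap.mulLeft ℚ (oddVar (r * k)) ∘ₗ dilate r)
    (dilate r ∘ₗ LinearMap.mulLeft ℚ (oddVar k) + nondivPart r (r * k) ∘ₗ dilate r))).2 ?_
    (span_schurWord f)
  rintro _ ⟨l, hl, rfl⟩
  simp only [SetLike.mem_coe, LinearMap.mem_eqLocus, LinearMap.comp_apply, LinearMap.add_apply,
    LinearMap.mulLeft_apply]
  induction l with
  | nil => rw [schurWord_nil, dilate_one hr0, mul_one, mul_one, oddVar_eq_dilate_add hr hk]
  | cons a l ih =>
    have ha : 0 < a := hl a (by simp)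
    have ih := ih fun k hk => hl k (List.mem_cons_of_mem _ hk)
    rw [schurWord_cons, dilate_vertexOp hr0 ha, oddVar_mul_vertexOp _ (hr.mul hk), ih,
      oddVar_mul_vertexOp _ hk, map_add, map_add, dilate_vertexOp hr0 ha,
      dilate_vertexOp hr0 (Nat.add_pos_left ha k), nondivPart_vertexOp (mul_pos hr0 ha), mul_add]
    abel

/-! ### Spanning after reduction. -/

/-- The preimage of the span of the reduced `Q`-functions of strict partitions without parts
divisible by `r`. -/
def reducedSpan (r : ℕ) : Submodule ℚ (OddPoly 0) :=
  (Submodule.span ℚ (Set.range fun μ : ReducedStrict r =>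
    reducePoly r (schurWord μ.1.parts))).comap (reducePoly r).toLinearMap

lemma schurWord_mem_reducedSpan {r : ℕ} {l : List ℕ} (hl : ∀ k ∈ l, ¬ r ∣ k) :
    schurWord l ∈ reducedSpan r := by
  have h := schurWord_mem_span
    (fun k hk => Nat.pos_of_ne_zero fun h => hl k hk (h ▸ dvd_zero r)) hl
  refine Submodule.span_le.2 ?_ h
  rintro _ ⟨μ, rfl⟩
  exact Submodule.subset_span ⟨μ, rfl⟩

lemma oddVar_mul_mem_reducedSpan {r k : ℕ} (h : r ∣ k) (f : OddPoly 0) :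
    oddVar k * f ∈ reducedSpan r := by
  have : reducePoly r (oddVar k * f) = 0 := by
    rw [map_mul, reducePoly_oddVar_of_dvd h, zero_mul]
  rw [reducedSpan, Submodule.mem_comap, AlgHom.toLinearMap_apply, this]
  exact Submodule.zero_mem _

/-- The operator that adds all elements of a list as parts. -/
def vertexOps (l : List ℕ) : Module.End ℚ (OddPoly 0) := (l.map vertexOp).prod

lemma vertexOps_cons (a : ℕ) (l : List ℕ) (f : OddPoly 0) :
    vertexOps (a :: l) f = vertexOp a (vertexOps l f) := by
  simp [vertexOps]

lemma vertexOps_append (l l' : List ℕ) (f : OddPoly 0) :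
    vertexOps (l ++ l') f = vertexOps l (vertexOps l' f) := by
  simp [vertexOps]

lemma vertexOps_schurWord (l l' : List ℕ) : vertexOps l (schurWord l') = schurWord (l ++ l') := by
  induction l with
  | nil => rfl
  | cons a l ih => rw [vertexOps_cons, ih]; rfl

/-- Multiplication by `p_m` commutes with adding parts, up to terms where a part is increased by
`m`. -/
lemma vertexOps_oddVar_mul_mem {r m : ℕ} (hm : Odd m) (hrm : r ∣ m) {V : Submodule ℚ (OddPoly 0)}
    {h : OddPoly 0} {l : List ℕ} (hl : ∀ k ∈ l, ¬ r ∣ k)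
    (hV : ∀ l : List ℕ, (∀ k ∈ l, ¬ r ∣ k) → vertexOps l h ∈ V) (s : List ℕ)
    (hs : ∀ k ∈ s, ¬ r ∣ k) :
    vertexOps s (vertexOps l (oddVar m * h)) - vertexOps s (oddVar m * vertexOps l h) ∈ V := by
  induction l generalizing s with
  | nil => simp [vertexOps]
  | cons a l ih =>
    have hl' : ∀ k ∈ l, ¬ r ∣ k := fun k hk => hl k (List.mem_cons_of_mem _ hk)
    have ha : ¬ r ∣ a := hl a (by simp)
    -- The prefix `s` collects the parts already passed, so that the induction works underneath
    -- them.
    have h1 := ih hl' (s ++ [a]) (by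
      simp only [List.mem_append, List.mem_singleton]
      rintro k (hk | rfl)
      exacts [hs k hk, ha])
    have h2 : vertexOps s (vertexOp (a + m) (vertexOps l h)) ∈ V := by
      rw [← vertexOps_cons, ← vertexOps_append]
      refine hV _ fun k hk => ?_
      rw [List.mem_append, List.mem_cons] at hk
      rcases hk with hk | rfl | hk
      exacts [hs k hk, fun h => ha ((Nat.dvd_add_left hrm).1 h), hl' k hk]
    rw [vertexOps_append, vertexOps_append] at h1
    simp only [vertexOps_cons] at h1 ⊢
    rw [oddVar_mul_vertexOp a hm, map_add, ← sub_sub]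
    exact V.sub_mem h1 h2

/-- The claim for `p_k f` follows from that for `f` with longer or altered lists `l`, hence the
quantifier over `l` inside the induction. -/
lemma vertexOps_dilate_mem_reducedSpan {r : ℕ} (hr : Odd r) (f : OddPoly 0) :
    ∀ l : List ℕ, (∀ k ∈ l, ¬ r ∣ k) → vertexOps l (dilate r f) ∈ reducedSpan r := by
  have key : f ∈ ⨅ (l : List ℕ) (_ : ∀ k ∈ l, ¬ r ∣ k),
      (reducedSpan r).comap (vertexOps l ∘ₗ dilate r) := by
    refine OddPoly.mem_of_mul_oddVar ?_ (fun k hk f hf => ?_) f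
    · simp only [Submodule.mem_iInf, Submodule.mem_comap, LinearMap.comp_apply]
      intro l hl
      rw [dilate_one hr.pos, ← schurWord_nil, vertexOps_schurWord, List.append_nil]
      exact schurWord_mem_reducedSpan hl
    · simp only [Submodule.mem_iInf, Submodule.mem_comap, LinearMap.comp_apply] at hf ⊢
      intro l hl
      -- `D (p_k f)` is rewritten as `p_{rk} D f - N (D f)`. Pulled to the front, `p_{rk}` reduces
      -- to `0`; each term of `N` appends the parts `rk - j` and `j`, neither divisible by `r`.
      rw [← add_sub_cancel_right (dilate r (oddVar k * f)) (nondivPart r (r * k) (dilate r f)),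
        ← oddVar_mul_dilate hr hk, map_sub]
      refine Submodule.sub_mem _ ?_ ?_
      · have h1 := vertexOps_oddVar_mul_mem (hr.mul hk) (dvd_mul_right r k) hl hf [] (by simp)
        rw [← sub_add_cancel (vertexOps l _)]
        exact Submodule.add_mem _ h1 (oddVar_mul_mem_reducedSpan (dvd_mul_right r k) _)
      · simp only [nondivPart, LinearMap.sum_apply, LinearMap.smul_apply, map_sum, map_smul,
          Module.End.mul_apply]
        refine Submodule.sum_mem _ fun j hj => Submodule.smul_mem _ _ ?_
        rw [Finset.mem_filter, Finset.mem_Ioo] at hj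
        have h1 := hf (l ++ [r * k - j, j]) (by
          simp only [List.mem_append, List.mem_cons, List.not_mem_nil, or_false]
          rintro i (hi | rfl | rfl)
          exacts [hl i hi, fun h => hj.2 ((Nat.dvd_sub_iff_right hj.1.2.le
            (dvd_mul_right r k)).1 h), hj.2])
        rw [vertexOps_append] at h1
        simpa [vertexOps] using h1
  simpa only [Submodule.mem_iInf, Submodule.mem_comap, LinearMap.comp_apply] using key

/-- Up to sign, the parts divisible by `r` can be moved to the end of a word, where they form the
dilation of a word. -/
lemma reducedSpan_eq_top {r : ℕ} (hr : Odd r) : reducedSpan r = ⊤ := by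
  refine top_le_iff.1 fun f _ => ?_
  refine (Submodule.span_le.2 ?_) (span_schurWord f)
  rintro _ ⟨l, hl, rfl⟩
  set l₁ := l.filter (fun k => ¬ r ∣ k)
  set l₂ := l.filter (fun k => r ∣ k) with hl₂
  have hperm : l.Perm (l₁ ++ l₂) := by
    refine (List.filter_append_perm (fun k => decide (r ∣ k)) l).symm.trans ?_
    simpa [l₁, l₂] using List.perm_append_comm
  obtain ⟨ε, h, -⟩ := schurWord_perm hperm hl one_pos
  have hmap : l₂ = (l₂.map (· / r)).map (r * ·) := by
    rw [List.map_map]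
    conv_lhs => rw [← List.map_id l₂]
    refine List.map_congr_left fun k hk => ?_
    have hk := (List.mem_filter.1 hk).2
    exact (Nat.mul_div_cancel' (by simpa using hk)).symm
  rw [SetLike.mem_coe, h]
  refine Submodule.smul_mem _ _ ?_
  rw [← vertexOps_schurWord, hmap, ← dilate_schurWord hr.pos]
  · exact vertexOps_dilate_mem_reducedSpan hr _ _ fun k hk => by
      simpa using (List.mem_filter.1 hk).2
  · intro k hk
    obtain ⟨i, hi, rfl⟩ := List.mem_map.1 hk
    have hi := List.mem_filter.1 hi
    exact Nat.div_pos (Nat.le_of_dvd (hl i hi.1) (by simpa using hi.2)) hr.pos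

lemma span_reducePoly_schurWord {r : ℕ} (hr : Odd r) : ⊤ ≤ Submodule.span ℚ
    (Set.range fun μ : ReducedStrict r => reducePoly r (schurWord μ.1.parts)) := by
  intro f _
  obtain ⟨g, rfl⟩ := reducePoly_surjective r f
  have : g ∈ reducedSpan r := reducedSpan_eq_top hr ▸ trivial
  exact this

/-- The basis of reduced `Q`-functions of strict partitions without parts divisible by `r`. -/
def reducedSchurBasis {r : ℕ} (hr : Odd r) : Module.Basis (ReducedStrict r) ℚ (OddPoly r) :=
  Module.Basis.mk (linearIndependent_reducePoly_of_span (span_reducePoly_schurWord hr))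
    (span_reducePoly_schurWord hr)


/-! ### Evaluation in finitely many variables. -/

section FiniteVariables

/-- Evaluation of the power sums at the variables `x_i`, `i ∈ S`. -/
def evalOn {F ι : Type*} [Field F] [Algebra ℚ F] (x : ι → F) (S : Finset ι) : OddPoly 0 →ₐ[ℚ] F :=
  aeval fun j => ∑ i ∈ S, x i ^ (j : ℕ)

lemma evalOn_oddVar {F ι : Type*} [Field F] [Algebra ℚ F] (x : ι → F) (S : Finset ι) {k : ℕ} (hk : Odd k) :
    evalOn x S (oddVar k) = ∑ i ∈ S, x i ^ k := by
  simp [evalOn, oddVar_of_odd hk]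

lemma evalOn_empty_schurq_succ {F ι : Type*} [Field F] [Algebra ℚ F] (x : ι → F) (n : ℕ) : evalOn x ∅ (schurq (n + 1)) = 0 := by
  have h := congrArg (evalOn x ∅) (schurq_succ n)
  have h0 (k : ℕ) : evalOn x ∅ (oddVar (k + 1)) = 0 := by
    by_cases hk : Odd (k + 1)
    · rw [evalOn_oddVar _ _ hk, Finset.sum_empty]
    · rw [oddVar_of_not_odd hk, map_zero]
  have : CharZero F := algebraRat.charZero F
  simp only [map_mul, map_add, map_natCast, map_one, map_sum, h0, zero_mul, Finset.sum_const_zero,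
    mul_zero, mul_eq_zero] at h
  exact h.resolve_left (Nat.cast_add_one_ne_zero n)

variable {F ι : Type*} [Field F] [DecidableEq ι]

/-- The factor `∏ (x_i + x_k) / (x_i - x_k)`, over `k ∈ S` different from `i`. -/
def crossFactor (x : ι → F) (S : Finset ι) (i : ι) : F :=
  ∏ k ∈ S.erase i, (x i + x k) / (x i - x k)

lemma crossFactor_insert_self (x : ι → F) {S : Finset ι} {z : ι} (hz : z ∉ S) :
    crossFactor x (insert z S) z = ∏ k ∈ S, (x z + x k) / (x z - x k) := by
  rw [crossFactor, Finset.erase_insert hz]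

lemma crossFactor_insert_of_mem (x : ι → F) {S : Finset ι} {z i : ι} (hz : z ∉ S) (hi : i ∈ S) :
    crossFactor x (insert z S) i = (x i + x z) / (x i - x z) * crossFactor x S i := by
  have hne : z ≠ i := fun h => hz (h ▸ hi)
  rw [crossFactor, Finset.erase_insert_of_ne hne, Finset.prod_insert, crossFactor]
  exact fun h => hz (Finset.mem_of_mem_erase h)

/-- Partial fractions for `∏ (y + x_k) / (y - x_k)`. -/
lemma prod_add_div_sub {x : ι → F} (hx : Function.Injective x) (S : Finset ι) (y : F)
    (hy : ∀ i ∈ S, y ≠ x i) :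
    ∏ k ∈ S, (y + x k) / (y - x k) = 1 + ∑ i ∈ S, 2 * x i * crossFactor x S i / (y - x i) := by
  induction S using Finset.induction_on generalizing y with
  | empty => simp
  | insert z S hz ih =>
    have hyz : y - x z ≠ 0 := sub_ne_zero.2 (hy z (by simp))
    have h1 := ih y fun i hi => hy i (by simp [hi])
    have h2 := ih (x z) fun i hi h => hz (hx h ▸ hi)
    rw [Finset.prod_insert hz, Finset.sum_insert hz, h1, crossFactor_insert_self x hz, h2]
    have h3 : ∑ i ∈ S, 2 * x i * crossFactor x (insert z S) i / (y - x i) =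
        ∑ i ∈ S, ((y + x z) / (y - x z) * (2 * x i * crossFactor x S i / (y - x i)) -
          2 * x z / (y - x z) * (2 * x i * crossFactor x S i / (x z - x i))) := by
      refine Finset.sum_congr rfl fun i hi => ?_
      rw [crossFactor_insert_of_mem x hz hi]
      have e1 : y - x i ≠ 0 := sub_ne_zero.2 (hy i (by simp [hi]))
      have e2 : x z - x i ≠ 0 := sub_ne_zero.2 fun h => hz (hx h ▸ hi)
      have e3 : x i - x z ≠ 0 := sub_ne_zero.2 fun h => hz (hx h ▸ hi)
      rw [← sub_eq_zero]
      have e4 : x i - x z = -(x z - x i) := by ring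
      rw [e4]
      field_simp
      ring
    rw [h3, Finset.sum_sub_distrib, ← Finset.mul_sum, ← Finset.mul_sum]
    field_simp
    ring

variable [Algebra ℚ F]

lemma evalOn_insert_oddVar (x : ι → F) {S : Finset ι} {z : ι} (hz : z ∉ S) (k : ℕ) (hk : Odd k) :
    evalOn x (insert z S) (oddVar k) = evalOn x S (oddVar k) + x z ^ k := by
  rw [evalOn_oddVar x _ hk, evalOn_oddVar x _ hk, Finset.sum_insert hz, add_comm]

/-- The functions `q_n` of finitely many variables. -/
lemma evalOn_schurq_succ {x : ι → F} (hx : Function.Injective x) (S : Finset ι) (n : ℕ) :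
    evalOn x S (schurq (n + 1)) = ∑ i ∈ S, 2 * x i ^ (n + 1) * crossFactor x S i := by
  induction S using Finset.induction_on generalizing n with
  | empty => rw [evalOn_empty_schurq_succ, Finset.sum_empty]
  | insert z S hz ih =>
    have hne {i : ι} (hi : i ∈ S) : x i - x z ≠ 0 := sub_ne_zero.2 fun h => hz (hx h ▸ hi)
    have hrec := map_schurq_add_variable (evalOn_insert_oddVar x hz)
    induction n with
    -- The recursion starts at `q_0 = 1`, which is not a sum of the claimed form; partial fractions
    -- at `y = x_z` make up for it.
    | zero =>
      have h := hrec 0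
      simp only [schurq_zero, map_one, mul_one] at h
      rw [ih 0] at h
      rw [eq_add_of_sub_eq h, Finset.sum_insert hz, crossFactor_insert_self x hz,
        prod_add_div_sub hx S (x z) fun i hi h => hz (hx h ▸ hi)]
      have h3 : ∑ i ∈ S, 2 * x i ^ (0 + 1) * crossFactor x (insert z S) i =
          ∑ i ∈ S, (2 * x i ^ (0 + 1) * crossFactor x S i -
            2 * x z * (2 * x i * crossFactor x S i / (x z - x i))) := by
        refine Finset.sum_congr rfl fun i hi => ?_
        rw [crossFactor_insert_of_mem x hz hi]
        have e1 := hne hi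
        have e2 : x z - x i = -(x i - x z) := by ring
        rw [e2]
        field_simp
        ring
      rw [h3, Finset.sum_sub_distrib, ← Finset.mul_sum]
      ring
    | succ n ihn =>
      have h := hrec (n + 1)
      rw [ih, ih, ihn] at h
      rw [eq_add_of_sub_eq h, Finset.sum_insert hz, Finset.sum_insert hz, mul_add, Finset.mul_sum,
        Finset.mul_sum, ← Finset.sum_add_distrib, add_left_comm, ← Finset.sum_add_distrib]
      congr 1
      · ring
      · refine Finset.sum_congr rfl fun i hi => ?_
        rw [crossFactor_insert_of_mem x hz hi]
        have e1 := hne hi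
        field_simp
        ring

/-- The operators `vertexOp` in finitely many variables. -/
lemma evalOn_vertexOp {x : ι → F} (hx : Function.Injective x) (S : Finset ι) {a : ℕ} (ha : 0 < a)
    (f : OddPoly 0) : evalOn x S (vertexOp a f) =
      ∑ i ∈ S, 2 * x i ^ a * crossFactor x S i * evalOn x (S.erase i) f := by
  let V : Submodule ℚ (OddPoly 0) :=
    { carrier := {f | ∀ a : ℕ, 0 < a → evalOn x S (vertexOp a f) =
        ∑ i ∈ S, 2 * x i ^ a * crossFactor x S i * evalOn x (S.erase i) f}
      zero_mem' := fun a _ => by simp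
      add_mem' := fun {f g} hf hg a ha => by
        simp only [map_add, hf a ha, hg a ha, mul_add, Finset.sum_add_distrib]
      smul_mem' := fun c f hf a ha => by
        rw [map_smul, map_smul, hf a ha, Algebra.smul_def, Finset.mul_sum]
        refine Finset.sum_congr rfl fun i _ => ?_
        rw [map_smul, Algebra.smul_def, mul_left_comm] }
  refine OddPoly.mem_of_mul_oddVar (V := V) ?_ ?_ f a ha
  · intro a ha
    obtain ⟨n, rfl⟩ := Nat.exists_eq_succ_of_ne_zero ha.ne'
    simp only [vertexOp_one, map_one, mul_one]
    exact evalOn_schurq_succ hx S n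
  · intro k hk f hf a ha
    -- Removing `x_i` lowers the power sum by `x_i^k`, which matches the commutation of `p_k` with
    -- the operator.
    rw [vertexOp_oddVar_mul a hk, map_sub, map_mul, hf a ha, hf (a + k) (by omega), Finset.mul_sum,
      ← Finset.sum_sub_distrib]
    refine Finset.sum_congr rfl fun i hi => ?_
    rw [map_mul, evalOn_oddVar x _ hk, evalOn_oddVar x _ hk, ← Finset.add_sum_erase S _ hi]
    ring

lemma Fin.sum_embedding_succ {M : Type*} [AddCommMonoid M] [Fintype ι] (n : ℕ) (S : Finset ι)
    (f : (Fin (n + 1) → ι) → M) :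
    ∑ e : Fin (n + 1) ↪ ι with ∀ j, e j ∈ S, f e =
      ∑ i ∈ S, ∑ e : Fin n ↪ ι with ∀ j, e j ∈ S.erase i, f (Fin.cons i e) := by
  rw [Finset.sum_sigma']
  symm
  refine Finset.sum_bij (fun p hp => ⟨Fin.cons p.1 p.2, Fin.cons_injective_iff.2 ⟨?_, p.2.injective⟩⟩)
    ?_ ?_ ?_ ?_
  · simp only [Finset.mem_sigma, Finset.mem_filter, Finset.mem_univ, true_and] at hp
    rintro ⟨j, hj⟩
    exact Finset.notMem_erase _ _ (hj ▸ hp.2 j)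
  · intro p hp
    simp only [Finset.mem_sigma, Finset.mem_filter, Finset.mem_univ, true_and] at hp ⊢
    exact Fin.cases hp.1 fun j => Finset.mem_of_mem_erase (hp.2 j)
  · rintro ⟨i, e⟩ hp ⟨i', e'⟩ hp' h
    have h1 : (Fin.cons i e : Fin (n + 1) → ι) = Fin.cons i' e' :=
      congrArg (fun e : Fin (n + 1) ↪ ι => (e : Fin (n + 1) → ι)) h
    obtain ⟨rfl, h2⟩ := Fin.cons_injective2 h1
    rw [DFunLike.coe_injective h2]
  · intro e he
    rw [Finset.mem_filter] at he
    refine ⟨⟨e 0, (Fin.succEmb n).trans e⟩, ?_, ?_⟩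
    · simp only [Finset.mem_sigma, Finset.mem_filter, Finset.mem_univ, true_and]
      exact ⟨he.2 0, fun j => Finset.mem_erase.2
        ⟨fun h => Fin.succ_ne_zero j (e.injective h), he.2 j.succ⟩⟩
    · ext j
      refine Fin.cases ?_ (fun j => ?_) j <;> simp
  · intro p hp
    rfl

/-- The Schur `Q`-functions of finitely many variables, as sums over sequences of distinct
variables. -/
lemma evalOn_schurWord [Fintype ι] {x : ι → F} (hx : Function.Injective x) (S : Finset ι)
    {l : List ℕ} (hl : ∀ k ∈ l, 0 < k) :
    evalOn x S (schurWord l) = 2 ^ l.length *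
      ∑ e : Fin l.length ↪ ι with ∀ j, e j ∈ S, ∏ i : Fin l.length, (x (e i) ^ l.get i *
        ∏ k ∈ S with ∀ i' ≤ i, k ≠ e i', (x (e i) + x k) / (x (e i) - x k)) := by
  induction l generalizing S with
  | nil => simp [schurWord_nil]
  | cons a l ih =>
    rw [schurWord_cons, evalOn_vertexOp hx S (hl a (by simp))]
    simp only [List.length_cons]
    rw [Fin.sum_embedding_succ l.length S (fun e => ∏ i, (x (e i) ^ (a :: l).get i *
        ∏ k ∈ S with ∀ i' ≤ i, k ≠ e i', (x (e i) + x k) / (x (e i) - x k))), Finset.mul_sum]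
    refine Finset.sum_congr rfl fun i hi => ?_
    rw [ih _ fun k hk => hl k (List.mem_cons_of_mem _ hk), Finset.mul_sum, Finset.mul_sum,
      Finset.mul_sum]
    refine Finset.sum_congr rfl fun e _ => ?_
    rw [Fin.prod_univ_succ]
    have h0 : (S.filter fun k => ∀ i' ≤ (0 : Fin (l.length + 1)),
        k ≠ (Fin.cons i e : Fin (l.length + 1) → ι) i') = S.erase i := by
      ext k
      simp [and_comm]
    have hs (j : Fin l.length) : (S.filter fun k => ∀ i' ≤ j.succ,
        k ≠ (Fin.cons i e : Fin (l.length + 1) → ι) i') =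
        (S.erase i).filter fun k => ∀ i' ≤ j, k ≠ e i' := by
      ext k
      simp [Fin.forall_fin_succ, Finset.mem_filter, Finset.mem_erase]
      tauto
    simp only [h0, hs, Fin.cons_zero, Fin.cons_succ, crossFactor, List.get_cons_zero,
      List.get_cons_succ']
    ring

end FiniteVariables

lemma evalOn_univ_schurWord {F : Type*} [Field F] [Algebra ℚ F] {n : ℕ} {x : Fin n → F}
    (hx : Function.Injective x) (μ : StrictPartition) :
    evalOn x Finset.univ (schurWord μ.parts) = hallLittlewoodQ x (-1) μ := by
  rw [evalOn_schurWord hx _ μ.pos, hallLittlewoodQ]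
  have h2 : (1 - (-1) : F) = 2 := by norm_num
  rw [h2]
  simp only [Finset.mem_univ, implies_true, Finset.filter_true, neg_one_mul, sub_neg_eq_add]
  rfl


/-! ### Algebraic independence of the odd power sums. -/

lemma MvPolynomial.coeff_pderiv_eq {σ R : Type*} [CommSemiring R] (i : σ) (f : MvPolynomial σ R)
    (s : σ →₀ ℕ) : coeff s (pderiv i f) = coeff (s + Finsupp.single i 1) f * (s i + 1) := by
  classical
  induction f using MvPolynomial.induction_on' with
  | add p q hp hq => rw [map_add, coeff_add, coeff_add, hp, hq, add_mul]
  | monomial t a =>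
    rw [pderiv_monomial, coeff_monomial, coeff_monomial]
    by_cases h : t = s + Finsupp.single i 1
    · subst h
      simp
    · rw [if_neg h, zero_mul]
      split_ifs with h'
      · have hi : t i = 0 := by
          by_contra hi
          refine h ?_
          rw [← h', tsub_add_cancel_of_le]
          rw [Finsupp.single_le_iff]
          omega
        rw [hi, Nat.cast_zero, mul_zero]
      · rfl

lemma MvPolynomial.totalDegree_pderiv_le {σ R : Type*} [CommSemiring R] (i : σ)
    {f : MvPolynomial σ R} {d : ℕ} (hf : f.totalDegree ≤ d + 1) :
    (pderiv i f).totalDegree ≤ d := by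
  refine Finset.sup_le fun s hs => ?_
  have h1 : s + Finsupp.single i 1 ∈ f.support := by
    rw [mem_support_iff, coeff_pderiv_eq] at hs
    rw [mem_support_iff]
    exact left_ne_zero_of_mul hs
  have h2 := (le_totalDegree h1).trans hf
  rw [Finsupp.sum_add_index' (by simp) (by simp), Finsupp.sum_single_index rfl] at h2
  omega

lemma MvPolynomial.eq_C_of_pderiv_eq_zero {σ : Type*} {f : MvPolynomial σ ℚ}
    (h : ∀ i, pderiv i f = 0) : f = C (coeff 0 f) := by
  classical
  ext s
  rw [coeff_C]
  split_ifs with hs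
  · rw [hs]
  · obtain ⟨i, hi⟩ := Finsupp.ne_iff.1 (Ne.symm hs)
    rw [Finsupp.zero_apply] at hi
    have h1 := MvPolynomial.coeff_pderiv_eq i f (s - Finsupp.single i 1)
    rw [h i, coeff_zero, tsub_add_cancel_of_le (by rw [Finsupp.single_le_iff]; omega)] at h1
    exact (mul_eq_zero.1 h1.symm).resolve_right (by positivity)

/-- The power sums in `n` variables. -/
def psumHom (r n : ℕ) : OddPoly r →ₐ[ℚ] MvPolynomial (Fin n) ℚ :=
  aeval fun j => psum (Fin n) ℚ j

lemma psumHom_X (r n : ℕ) (i : OddIndex r) : psumHom r n (X i) = psum (Fin n) ℚ i := by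
  simp [psumHom]

lemma pderiv_psum {n : ℕ} (k : Fin n) (j : ℕ) :
    pderiv k (psum (Fin n) ℚ j) = (j : MvPolynomial (Fin n) ℚ) * X k ^ (j - 1) := by
  rw [psum, map_sum, Finset.sum_eq_single k]
  · rw [Derivation.leibniz_pow, pderiv_X_self, smul_eq_mul, mul_one, nsmul_eq_mul]
  · intro i _ hi
    rw [Derivation.leibniz_pow, pderiv_X_of_ne hi, smul_zero, smul_zero]
  · simp

/-- The chain rule. The finite index set does not depend on `n` and may be enlarged, so that `n` can
later be taken beyond all its indices. -/
lemma exists_pderiv_psumHom (r : ℕ) (f : OddPoly r) : ∃ S : Finset (OddIndex r), ∀ S', S ⊆ S' →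
    ∀ n (k : Fin n), pderiv k (psumHom r n f) =
      ∑ i ∈ S', psumHom r n (pderiv i f) *
        (((i : ℕ) : MvPolynomial (Fin n) ℚ) * X k ^ ((i : ℕ) - 1)) := by
  classical
  induction f using MvPolynomial.induction_on with
  | C c => exact ⟨∅, fun S' _ n k => by simp [psumHom]⟩
  | add f g hf hg =>
    obtain ⟨S, hS⟩ := hf
    obtain ⟨T, hT⟩ := hg
    refine ⟨S ∪ T, fun S' h n k => ?_⟩
    simp only [map_add, add_mul, Finset.sum_add_distrib]
    rw [hS S' (Finset.union_subset_left h), hT S' (Finset.union_subset_right h)]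
  | mul_X f j hf =>
    obtain ⟨S, hS⟩ := hf
    refine ⟨insert j S, fun S' h n k => ?_⟩
    have hj : j ∈ S' := h (Finset.mem_insert_self _ _)
    simp only [map_mul, Derivation.leibniz, smul_eq_mul, map_add, add_mul, Finset.sum_add_distrib,
      psumHom_X, pderiv_psum]
    rw [hS S' ((Finset.subset_insert _ _).trans h), Finset.mul_sum]
    congr 1
    · rw [Finset.sum_eq_single j]
      · rw [pderiv_X_self, map_one, mul_one]
      · intro i _ hi
        rw [pderiv_X_of_ne hi.symm, map_zero, mul_zero, zero_mul]
      · exact fun h => absurd hj h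
    · exact Finset.sum_congr rfl fun i _ => by ring

/-- The odd power sums are algebraically independent. -/
lemma eq_zero_of_psumHom_eq_zero {r : ℕ} {f : OddPoly r} {N : ℕ}
    (hf : ∀ n, N ≤ n → psumHom r n f = 0) : f = 0 := by
  classical
  suffices h : ∀ (d : ℕ) (f : OddPoly r) (N : ℕ), f.totalDegree ≤ d →
      (∀ n, N ≤ n → psumHom r n f = 0) → f = 0 from h _ f N le_rfl hf
  intro d
  have const (f : OddPoly r) (N : ℕ) (c : ℚ) (hc : f = C c) (h : ∀ n, N ≤ n → psumHom r n f = 0) :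
      f = 0 := by
    have := h N le_rfl
    rw [hc] at this
    have h0 : c = 0 := by simpa [psumHom] using this
    rw [hc, h0, C_0]
  induction d with
  | zero =>
    intro f N hd h
    exact const f N _ (totalDegree_eq_zero_iff_eq_C.1 (Nat.le_zero.1 hd)) h
  | succ d ih =>
    intro f N hd h
    refine const f N _ (eq_C_of_pderiv_eq_zero fun i => ?_) h
    obtain ⟨S, hS⟩ := exists_pderiv_psumHom r f
    set S' := insert i S
    refine ih _ (max N ((S'.sup fun i => (i : ℕ)) + 1)) (totalDegree_pderiv_le i hd) fun n hn => ?_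
    -- By the chain rule `p` takes the value `∂f/∂x_k = 0` at each of the `n` variables; its degree
    -- is below `n`, so its coefficients vanish, and with them the images of the `∂f/∂p_i`, whose
    -- degree is smaller.
    let p : Polynomial (MvPolynomial (Fin n) ℚ) := ∑ i ∈ S',
      Polynomial.monomial ((i : ℕ) - 1) (psumHom r n (pderiv i f) * (i : ℕ))
    have hp : p = 0 := by
      refine Polynomial.eq_zero_of_natDegree_lt_card_of_eval_eq_zero p (X_injective (σ := Fin n))
        (fun k => ?_) ?_
      · have h1 := hS S' (Finset.subset_insert _ _) n k
        rw [h n ((le_max_left _ _).trans hn), map_zero] at h1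
        rw [h1, Polynomial.eval_finsetSum]
        exact Finset.sum_congr rfl fun i _ => by rw [Polynomial.eval_monomial, mul_assoc]
      · rw [Fintype.card_fin]
        refine lt_of_le_of_lt (Polynomial.natDegree_sum_le_of_forall_le (n := S'.sup fun i => (i : ℕ))
          _ _ fun j hj => ?_) ((le_max_right _ _).trans hn)
        exact (Polynomial.natDegree_monomial_le _).trans
          ((Nat.sub_le _ _).trans (Finset.le_sup (f := fun i : OddIndex r => (i : ℕ)) hj))
    have hc := congrArg (fun p => Polynomial.coeff p ((i : ℕ) - 1)) hp
    simp only [p, Polynomial.finsetSum_coeff, Polynomial.coeff_zero] at hc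
    rw [Finset.sum_eq_single i] at hc
    · rw [Polynomial.coeff_monomial_same] at hc
      exact (mul_eq_zero.1 hc).resolve_right (Nat.cast_ne_zero.2 i.2.1.pos.ne')
    · intro j _ hj
      rw [Polynomial.coeff_monomial, if_neg]
      intro h'
      have h1 := i.2.1.pos
      have h2 := j.2.1.pos
      exact hj (Subtype.ext (by omega))
    · exact fun h' => absurd (Finset.mem_insert_self _ _) h'

/-! ### Transfer to symmetric functions. -/

/-- The symmetric function given by a polynomial in the power sums. -/
def toSymmFun (r : ℕ) : OddPoly r →ₐ[ℚ] symmFun :=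
  aeval fun j => powerSum j j.2.1.pos.ne'

lemma toSymmFun_apply (r n : ℕ) (f : OddPoly r) : (toSymmFun r f).1 n = psumHom r n f := by
  have h : ((Pi.evalAlgHom ℚ (fun n : ℕ => MvPolynomial (Fin n) ℚ) n).comp symmFun.val).comp
      (toSymmFun r) = psumHom r n := by
    refine MvPolynomial.algHom_ext fun i => ?_
    rw [psumHom_X, AlgHom.comp_apply, toSymmFun, aeval_X]
    rfl
  exact DFunLike.congr_fun h f

lemma toSymmFun_injective (r : ℕ) : Function.Injective (toSymmFun r) := by
  rw [injective_iff_map_eq_zero]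
  intro f hf
  refine eq_zero_of_psumHom_eq_zero (N := 0) fun n _ => ?_
  rw [← toSymmFun_apply, hf]
  rfl

lemma range_toSymmFun (r : ℕ) : (toSymmFun r).range = gammaRQ r := by
  rw [toSymmFun, ← Algebra.adjoin_range_eq_range_aeval, gammaRQ]
  congr 1
  ext f
  constructor
  · rintro ⟨i, rfl⟩
    exact ⟨i, i.2.1, i.2.2, rfl⟩
  · rintro ⟨j, hj, hr, rfl⟩
    exact ⟨⟨j, hj, hr⟩, rfl⟩

lemma gammaRQ_zero : gammaRQ 0 = gammaQ := by
  rw [gammaRQ, gammaQ]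
  congr 1
  ext f
  constructor
  · rintro ⟨j, hj, -, rfl⟩
    exact ⟨j, hj, rfl⟩
  · rintro ⟨j, hj, rfl⟩
    exact ⟨j, hj, (odd_index_zero hj).2, rfl⟩

/-- `Γ^{(r)}_ℚ` is a polynomial ring. -/
def gammaRQEquiv (r : ℕ) : OddPoly r ≃ₐ[ℚ] gammaRQ r :=
  (AlgEquiv.ofInjective _ (toSymmFun_injective r)).trans
    (Subalgebra.equivOfEq _ _ (range_toSymmFun r))

lemma coe_gammaRQEquiv (r : ℕ) (f : OddPoly r) : (gammaRQEquiv r f : symmFun) = toSymmFun r f := rfl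

/-- `Γ_ℚ` is a polynomial ring. -/
def gammaQEquiv : OddPoly 0 ≃ₐ[ℚ] gammaQ :=
  (gammaRQEquiv 0).trans (Subalgebra.equivOfEq _ _ gammaRQ_zero)

lemma coe_gammaQEquiv (f : OddPoly 0) : (gammaQEquiv f : symmFun) = toSymmFun 0 f := rfl

lemma isSchurQ_gammaQEquiv (μ : StrictPartition) :
    IsSchurQ μ (gammaQEquiv (schurWord μ.parts)) := by
  intro n
  have hx : Function.Injective fun i : Fin n =>
      algebraMap (MvPolynomial (Fin n) ℚ) (FractionRing (MvPolynomial (Fin n) ℚ)) (X i) :=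
    (IsFractionRing.injective _ _).comp (X_injective (σ := Fin n) (R := ℚ))
  rw [← evalOn_univ_schurWord hx, coe_gammaQEquiv, toSymmFun_apply]
  have h : (IsScalarTower.toAlgHom ℚ (MvPolynomial (Fin n) ℚ)
      (FractionRing (MvPolynomial (Fin n) ℚ))).comp (psumHom 0 n) = evalOn (fun i : Fin n =>
      algebraMap (MvPolynomial (Fin n) ℚ) (FractionRing (MvPolynomial (Fin n) ℚ)) (X i))
      Finset.univ := by
    refine MvPolynomial.algHom_ext fun i => ?_
    rw [AlgHom.comp_apply, psumHom_X, evalOn, aeval_X, psum, map_sum]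
    exact Finset.sum_congr rfl fun k _ => map_pow _ _ _
  exact DFunLike.congr_fun h _

/-- The reduction `Γ_ℚ → Γ^{(r)}_ℚ`. -/
def gammaReduction (r : ℕ) : gammaQ →ₐ[ℚ] gammaRQ r :=
  ((gammaRQEquiv r).toAlgHom.comp (reducePoly r)).comp gammaQEquiv.symm.toAlgHom

lemma gammaReduction_gammaQEquiv (r : ℕ) (f : OddPoly 0) :
    gammaReduction r (gammaQEquiv f) = gammaRQEquiv r (reducePoly r f) := by
  simp [gammaReduction]

lemma isReduction_gammaReduction (r : ℕ) : IsReduction r (gammaReduction r) := by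
  intro j hj
  have h1 : (⟨powerSum j hj.pos.ne', powerSum_mem_gammaQ hj⟩ : gammaQ) =
      gammaQEquiv (oddVar j) := by
    refine Subtype.ext ?_
    rw [coe_gammaQEquiv, oddVar_of_odd hj, toSymmFun, aeval_X]
  rw [h1, gammaReduction_gammaQEquiv]
  refine ⟨fun h => by rw [reducePoly_oddVar_of_dvd h, map_zero], fun h => Subtype.ext ?_⟩
  rw [reducePoly_oddVar hj h, coe_gammaRQEquiv, toSymmFun, aeval_X]

lemma StrictPartition.barQuotientZero_eq_empty_iff (μ : StrictPartition) (r : ℕ) :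
    μ.barQuotientZero r = ∅ ↔ ∀ k ∈ μ.parts, ¬ r ∣ k := by
  rw [Set.eq_empty_iff_forall_notMem]
  constructor
  · rintro h _ hk ⟨x, rfl⟩
    obtain ⟨i, hi⟩ := List.mem_iff_get.1 hk
    exact h x ⟨i, hi⟩
  · rintro h x ⟨i, hi⟩
    exact h _ (List.get_mem μ.parts i) ⟨x, hi⟩

end

theorem proposition2p1 (r : ℕ) (hr : Odd r) :
    ∃ (Q : StrictPartition → gammaQ) (ρ : gammaQ →ₐ[ℚ] gammaRQ r),
      (∀ μ, IsSchurQ μ (Q μ)) ∧ IsReduction r ρ ∧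
      ∃ b : Module.Basis {μ : StrictPartition // μ.barQuotientZero r = ∅} ℚ (gammaRQ r),
        ∀ μ, b μ = ρ (Q μ) := by
  refine ⟨fun μ => gammaQEquiv (schurWord μ.parts), gammaReduction r, isSchurQ_gammaQEquiv,
    isReduction_gammaReduction r,
    ((reducedSchurBasis hr).map (gammaRQEquiv r).toLinearEquiv).reindex
      (Equiv.subtypeEquivRight fun μ => (μ.barQuotientZero_eq_empty_iff r).symm), fun μ => ?_⟩
  rw [gammaReduction_gammaQEquiv, Module.Basis.reindex_apply, Module.Basis.map_apply,
    reducedSchurBasis, Module.Basis.mk_apply]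
  rfl
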